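/- Consider synchronous anonymous quantum networks: the underlying graph is a strongly connected digraph $G$ with $n\ge 1$ nodes (parties), possibly with parallel edges and self-loops, every party numbers its incoming links and its outgoing links arbitrarily (in-ports and out-ports), and all parties run the same quantum algorithm, knowing initially only their own numbers of in-ports and out-ports and a common upper bound $N\ge n$. In each round every party applies a trace-preserving completely positive map to its local register and the registers received through its in-ports, and sends quantum registers through its out-ports. The leader election problem $\mathsf{LE}_n$ asks that exactly one party, no matter which, outputs $1$ and all others output $0$. For every constant $\varepsilon\in(0,1)$ there is a quantum algorithm such that, for every $n\ge 1$, every upper bound $N\ge n$ given to all parties, every strongly connected digraph $G$ with $n$ nodes (unknown to the parties) and every port numbering of $G$: 1. (zero error) with certainty, either the parties solve $\mathsf{LE}_n$ correctly or all of them give up, and the first happens with probability at least $1-\varepsilon$; 2. the algorithm runs in $O(N)$ rounds; 3. if $G$ has $O(N^2)$ edges (in particular, if $G$ has no parallel edges), the number of bits and qubits communicated is $\tilde O(N^9)$. More precisely, there is an integer $k$, depending only on $\varepsilon$, such that for every integer $K\ge 0$ there is a constant $C$, depending only on $\varepsilon$ and $K$, such that at most $C N^9(1+\log N)^k$ bits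 and qubits are communicated whenever $G$ has at most $KN^2$ edges. -/

import Mathlib

/-! ## Anonymous networks: digraphs with port numberings -/

/-- A finite digraph on the node set `Fin n`; parallel edges and self-loops are allowed. -/
structure MultiDigraph (n : ℕ) where
  /-- the number of edges -/
  numEdges : ℕ
  /-- the source of an edge -/
  src : Fin numEdges → Fin n
  /-- the target of an edge -/
  tgt : Fin numEdges → Fin n

namespace MultiDigraph

/-- Every node can be reached from every node along directed edges. -/
def StronglyConnected {n : ℕ} (G : MultiDigraph n) : Prop :=
  ∀ u v : Fin n, Relation.ReflTransGen (fun a b => ∃ e, G.src e = a ∧ G.tgt e = b) u v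

/-- The in-degree of a node. -/
def inDeg {n : ℕ} (G : MultiDigraph n) (v : Fin n) : ℕ := Fintype.card {e // G.tgt e = v}

/-- The out-degree of a node. -/
def outDeg {n : ℕ} (G : MultiDigraph n) (v : Fin n) : ℕ := Fintype.card {e // G.src e = v}

/-- A port numbering: every node numbers its incoming edges and its outgoing edges,
independently of the other nodes. -/
structure PortNumbering {n : ℕ} (G : MultiDigraph n) where
  /-- numbering of the incoming edges of a node -/
  inPort : ∀ v : Fin n, {e // G.tgt e = v} ≃ Fin (G.inDeg v)
  /-- numbering of the outgoing edges of a node -/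
  outPort : ∀ v : Fin n, {e // G.src e = v} ≃ Fin (G.outDeg v)

end MultiDigraph

/-! ## Local quantum operations and distributed quantum algorithms -/

/-- A trace-preserving completely positive super-operator, given by a Kraus decomposition
`ρ ↦ ∑ₐ Kₐ ρ Kₐ†` with `∑ₐ Kₐ† Kₐ = 1`, from the quantum system with computational basis `X`
to the one with computational basis `Y`. Here `kraus a x y` is the matrix entry `⟨y| Kₐ |x⟩`. -/
structure SuperOperator (Outcome X Y : Type) where
  /-- the matrix entries of the Kraus operators -/
  kraus : Outcome → X → Y → ℂ
  /-- a basis state is mapped to finite superpositions, by finitely many Kraus operators -/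
  finite_support : ∀ x, {p : Outcome × Y | kraus p.1 x p.2 ≠ 0}.Finite
  /-- the diagonal entries of `∑ₐ Kₐ† Kₐ` are `1` -/
  normalized : ∀ x, ∑ᶠ p : Outcome × Y, star (kraus p.1 x p.2) * kraus p.1 x p.2 = 1
  /-- the off-diagonal entries of `∑ₐ Kₐ† Kₐ` are `0` -/
  orthogonal : ∀ x x', x ≠ x' →
    ∑ᶠ p : Outcome × Y, star (kraus p.1 x p.2) * kraus p.1 x' p.2 = 0

/-- Basis states of a message register: a register of `k` qubits has as its computational basis
the bit strings of length `k`. The empty string means that nothing is sent. -/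
abbrev Message : Type := List Bool

/-- The classical outputs of a party in zero-error leader election. -/
inductive LEOutput where
  | leader
  | follower
  | giveUp

/-- What a party with `dIn` in-ports and `dOut` out-ports runs, in a synchronous network. In round
`t` (counted from `0`) a super-operator `step t` acts on the local register and on the messages
that came in through the in-ports, and produces the new local register and one message register
for each out-port. How many qubits are sent through which port is decided classically: these
numbers are determined by the index of the Kraus operator that occurs. -/
structure PartyProgram (dIn dOut : ℕ) where
  /-- computational basis of the local register -/
  State : Type
  /-- indices of the Kraus operators (classical information left to the environment) -/
  Outcome : Type
  /-- the initial local state -/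
  init : State
  /-- the local operation of each round -/
  step : ℕ → SuperOperator Outcome (State × (Fin dIn → Message)) (State × (Fin dOut → Message))
  /-- the number of qubits sent through each out-port -/
  sentLength : Outcome → Fin dOut → ℕ
  length_eq : ∀ t a x y, (step t).kraus a x y ≠ 0 → ∀ p, (y.2 p).length = sentLength a p
  /-- the classical output, read from the local register by a measurement in the computational
  basis after the last round -/
  output : State → LEOutput

/-- A quantum algorithm for leader election on anonymous networks: what a party runs depends only
on the common global information `N` and on its own numbers of in-ports and out-ports; the number
of rounds depends only on `N`. -/
structure AnonymousQuantumAlgorithm where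
  /-- the number of rounds -/
  rounds : ℕ → ℕ
  /-- the program of a party with the given numbers of in-ports and out-ports -/
  party : (N dIn dOut : ℕ) → PartyProgram dIn dOut

namespace AnonymousQuantumAlgorithm

open MultiDigraph

variable (A : AnonymousQuantumAlgorithm) (N : ℕ) {n : ℕ} (G : MultiDigraph n)

/-- The program run by party `v`. -/
abbrev prog (v : Fin n) : PartyProgram (G.inDeg v) (G.outDeg v) :=
  A.party N (G.inDeg v) (G.outDeg v)

/-- Computational basis of the whole network at the end of a round: for each party its local
register and the messages that it has put on its out-ports. -/
abbrev Config : Type := ∀ v : Fin n, (A.prog N G v).State × (Fin (G.outDeg v) → Message)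

/-- A choice of one Kraus operator index for each party. -/
abbrev Outcomes : Type := ∀ v : Fin n, (A.prog N G v).Outcome

/-- The initial basis state: every party is in its initial state and no messages are under way. -/
def initConfig : Config A N G := fun v => ((A.prog N G v).init, fun _ => [])

variable {A N G}

/-- What party `v` receives: through in-port `j`, the message that the source of the edge
attached to in-port `j` has put on the out-port attached to that edge. -/
def received (σ : PortNumbering G) (c : Config A N G) (v : Fin n) : Fin (G.inDeg v) → Message :=
  fun j =>
    let e := ((σ.inPort v).symm j).1
    (c (G.src e)).2 (σ.outPort (G.src e) ⟨e, rfl⟩)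

/-- The (unnormalized) state vector of the network on the branch on which the Kraus operators with
the listed indices have occurred, the latest round first. In each round every party applies its
Kraus operator to its local register and to the messages it receives. The density operator of the
network after `T` rounds is the sum of `|ψ⟩⟨ψ|` over the branches `ψ` with lists of length `T`. -/
noncomputable def branch (σ : PortNumbering G) : List (Outcomes A N G) → Config A N G → ℂ
  | [], c => Set.indicator {initConfig A N G} 1 c
  | a :: h, c => ∑ᶠ c' : Config A N G, branch σ h c' *
      ∏ v, ((A.prog N G v).step h.length).kraus (a v) ((c' v).1, received σ c' v) (c v)

/-- The number of (qu)bits communicated, in the whole network, on a branch. -/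
def bitsSent : List (Outcomes A N G) → ℕ
  | [] => 0
  | a :: h => (∑ v, ∑ p, (A.prog N G v).sentLength (a v) p) + bitsSent h

/-- What party `v` outputs in a basis state of the network. -/
def outputAt (c : Config A N G) (v : Fin n) : LEOutput := (A.prog N G v).output (c v).1

variable (A N)

/-- The joint output `o` of the parties occurs with positive probability. -/
def OutputPossible (σ : PortNumbering G) (o : Fin n → LEOutput) : Prop :=
  ∃ (h : List (Outcomes A N G)) (c : Config A N G),
    h.length = A.rounds N ∧ outputAt c = o ∧ branch σ h c ≠ 0

/-- The probability that the joint output of the parties lies in `S`. -/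
noncomputable def outputProb (σ : PortNumbering G) (S : Set (Fin n → LEOutput)) : ℝ :=
  ∑ᶠ (p : List (Outcomes A N G) × Config A N G) (_ : p.1.length = A.rounds N ∧ outputAt p.2 ∈ S),
    ‖branch σ p.1 p.2‖ ^ 2

/-- In every execution (of positive probability) at most `B` bits or qubits are communicated. -/
def BitComplexityAtMost (σ : PortNumbering G) (B : ℝ) : Prop :=
  ∀ h : List (Outcomes A N G), h.length = A.rounds N → (∃ c, branch σ h c ≠ 0) →
    (bitsSent h : ℝ) ≤ B

end AnonymousQuantumAlgorithm

/-- Joint outputs that elect a unique leader. -/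
def uniqueLeader (n : ℕ) : Set (Fin n → LEOutput) :=
  {o | ∃ k, o k = LEOutput.leader ∧ ∀ i, i ≠ k → o i = LEOutput.follower}

/-- The joint output in which every party gives up. -/
def allGiveUp (n : ℕ) : Fin n → LEOutput := fun _ => LEOutput.giveUp

/-- Given the bound `N`, the algorithm solves leader election with zero error on the network
`(G, σ)`: every possible joint output elects a unique leader or is the common decision to give up,
and a unique leader is elected with probability at least `1 - ε`. -/
def AnonymousQuantumAlgorithm.SolvesLEZeroError (A : AnonymousQuantumAlgorithm) (N : ℕ) {n : ℕ}
    {G : MultiDigraph n} (σ : G.PortNumbering) (ε : ℝ) : Prop :=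
  (∀ o, A.OutputPossible N σ o → o ∈ uniqueLeader n ∨ o = allGiveUp n) ∧
    1 - ε ≤ A.outputProb N σ (uniqueLeader n)

/-! Each party draws a random identifier from `R = N ^ 2 * c + 1` values, prepares a uniform
superposition of bit strings of length `N * R`, and sends a copy of its string, with identifier and
out-port, along every outgoing edge. In round 1 it measures the parities between its own string and
the received ones, then measures its own string. The resulting classical records are flooded for `N`
rounds. If they are consistent with distinct identifiers (`Plausible`), the largest identifier wins;
otherwise all give up. Everybody ends up with the same set of records, so this decision is
unanimous.

The danger is a plausible set of records although identifiers repeat. In that case the parties with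
equal identifiers correspond to each other along edges, so strong connectivity makes every
identifier in use shared by the same number `k` of parties (`card_ident_le`), and these parties also
agree in bit string and outcomes. Quantum interference excludes this for `k ≥ 2`. Once the parities
are known, the compatible assignments of strings are exactly the simultaneous shifts of one
assignment by a string `β`, so the amplitude of the outcomes is a sum over `β`
(`exists_probe_of_branch_ne_zero`). For every order `k` and identifier `i` one bit is reserved for a
test: a party measures it in the vectors `(1, ω) / √k`, where `ω ^ k` is `-1` for identifier `i` and
`1` for the others. In the bad case the `k` equal phases of each class multiply to this sign, the
contributions of the two values of the shift bit cancel, and the amplitude vanishes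
(`interference_eq_zero`). Hence plausible records imply distinct identifiers
(`injective_of_plausible`).

Conversely, distinct identifiers always give plausible records, and by the birthday bound they are
distinct with probability at least `1 - 1 / c` (`one_sub_le_outputProb`). The communication is
dominated by the flooding (`bitsSent_le`). -/

/-! ### Tensor products of local operations preserve the norm. -/

section TensorIsometry

open Classical in
/-- Local operations of all parties together preserve the norm of the state. -/
theorem SuperOperator.sum_norm_sq_tensor {V : Type} [Fintype V] {O X Y : V → Type}
    (S : ∀ v, SuperOperator (O v) (X v) (Y v)) {C : Type} (I : C → ∀ v, X v)
    (hI : Function.Injective I) (ψ : C → ℂ) (hψ : (Function.support ψ).Finite) :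
    (Function.support fun p : (∀ v, O v) × (∀ v, Y v) =>
        ∑ᶠ c, ψ c * ∏ v, (S v).kraus (p.1 v) (I c v) (p.2 v)).Finite ∧
      ∑ᶠ p : (∀ v, O v) × (∀ v, Y v),
          ‖∑ᶠ c, ψ c * ∏ v, (S v).kraus (p.1 v) (I c v) (p.2 v)‖ ^ 2 =
        ∑ᶠ c, ‖ψ c‖ ^ 2 := by
  set s : Finset C := hψ.toFinset with hs
  set F : ∀ v, Finset (O v × Y v) :=
    fun v => s.biUnion fun c => ((S v).finite_support (I c v)).toFinset with hF
  set f : (∀ v, O v × Y v) → ℂ :=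
    fun g => ∑ c ∈ s, ψ c * ∏ v, (S v).kraus (g v).1 (I c v) (g v).2 with hf
  have hfin : ∀ p : (∀ v, O v) × (∀ v, Y v),
      ∑ᶠ c, ψ c * ∏ v, (S v).kraus (p.1 v) (I c v) (p.2 v) = f fun v => (p.1 v, p.2 v) := by
    intro p
    apply finsum_eq_sum_of_support_subset
    intro c hc
    simp only [Function.mem_support] at hc
    simpa [hs] using left_ne_zero_of_mul hc
  have hsupp : Function.support f ⊆ ↑(Fintype.piFinset F) := by
    intro g hg
    obtain ⟨c, hc, hne⟩ := Finset.exists_ne_zero_of_sum_ne_zero hg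
    simp only [Finset.mem_coe, Fintype.mem_piFinset]
    intro v
    have := Finset.prod_ne_zero_iff.1 (right_ne_zero_of_mul hne) v (Finset.mem_univ v)
    exact Finset.mem_biUnion.2 ⟨c, hc, by simpa using this⟩
  let e : (∀ v, O v) × (∀ v, Y v) → ∀ v, O v × Y v := fun p v => (p.1 v, p.2 v)
  have he : Function.Bijective e :=
    ⟨fun p q h => Prod.ext (funext fun v => congrArg Prod.fst (congrFun h v))
        (funext fun v => congrArg Prod.snd (congrFun h v)),
      fun g => ⟨(fun v => (g v).1, fun v => (g v).2), rfl⟩⟩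
  -- The Gram matrix of the tensor product is the product of the local Gram matrices, each of them
  -- an identity matrix. Injectivity of `I` supplies a party at which distinct `c`, `c'` have
  -- different inputs.
  have hgram : ∀ c ∈ s, ∀ c' ∈ s, ∑ g ∈ Fintype.piFinset F,
      ∏ v, star ((S v).kraus (g v).1 (I c v) (g v).2) * (S v).kraus (g v).1 (I c' v) (g v).2 =
        if c = c' then 1 else 0 := by
    intro c hc c' hc'
    rw [← Finset.prod_univ_sum F fun v p =>
      star ((S v).kraus p.1 (I c v) p.2) * (S v).kraus p.1 (I c' v) p.2]
    have key : ∀ v, ∑ p ∈ F v, star ((S v).kraus p.1 (I c v) p.2) * (S v).kraus p.1 (I c' v) p.2 =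
        if I c v = I c' v then 1 else 0 := by
      intro v
      rw [← finsum_eq_sum_of_support_subset]
      · split_ifs with h
        · rw [← h]; exact (S v).normalized _
        · exact (S v).orthogonal _ _ h
      · intro p hp
        have := right_ne_zero_of_mul hp
        exact Finset.mem_coe.2 (Finset.mem_biUnion.2 ⟨c', hc', by simpa using this⟩)
    rw [Finset.prod_congr rfl fun v _ => key v]
    split_ifs with h
    · subst h; simp
    · obtain ⟨v, hv⟩ := Function.ne_iff.1 (hI.ne h)
      exact Finset.prod_eq_zero (Finset.mem_univ v) (by simp [hv])
  constructor
  · have : (Function.support fun p : (∀ v, O v) × (∀ v, Y v) =>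
        ∑ᶠ c, ψ c * ∏ v, (S v).kraus (p.1 v) (I c v) (p.2 v)) = e ⁻¹' Function.support f := by
      ext p; simp only [Function.mem_support, Set.mem_preimage, hfin p, e]
    rw [this]
    exact ((Fintype.piFinset F).finite_toSet.subset hsupp).preimage he.1.injOn
  · rw [finsum_eq_of_bijective e he (g := fun g => ‖f g‖ ^ 2) fun p => by rw [hfin p],
      finsum_eq_sum_of_support_subset (s := Fintype.piFinset F) _ (fun g hg => hsupp (by
        simpa using hg)),
      finsum_eq_sum_of_support_subset (s := s) _ (fun c hc => by simpa [hs] using hc)]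
    apply Complex.ofReal_injective
    push_cast
    have hn : ∀ z : ℂ, (‖z‖ : ℂ) ^ 2 = star z * z := fun z => (Complex.conj_mul' z).symm
    simp only [hn, hf, star_sum, star_mul', Finset.sum_mul_sum]
    rw [Finset.sum_comm]
    refine Finset.sum_congr rfl fun c hc => ?_
    rw [Finset.sum_comm]
    have : ∀ c' ∈ s, ∑ g ∈ Fintype.piFinset F,
        star (ψ c) * star (∏ v, (S v).kraus (g v).1 (I c v) (g v).2) *
          (ψ c' * ∏ v, (S v).kraus (g v).1 (I c' v) (g v).2) =
        star (ψ c) * ψ c' * if c = c' then 1 else 0 := by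
      intro c' hc'
      rw [← hgram c hc c' hc', Finset.mul_sum]
      refine Finset.sum_congr rfl fun g _ => ?_
      rw [star_prod, Finset.prod_mul_distrib]
      ring
    rw [Finset.sum_congr rfl this]
    simp [hc]

end TensorIsometry

/-! ### Conservation of probability along branches. -/

namespace AnonymousQuantumAlgorithm

open MultiDigraph

section Probability

variable {A : AnonymousQuantumAlgorithm} {N n : ℕ} {G : MultiDigraph n}

/-- The local registers together with the messages received determine the configuration. -/
theorem received_injective (σ : PortNumbering G) :
    Function.Injective fun (c : Config A N G) (v : Fin n) => ((c v).1, received σ c v) := by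
  intro c c' h
  have hc : ∀ v, (c v).1 = (c' v).1 ∧ received σ c v = received σ c' v :=
    fun v => Prod.mk.inj (congrFun h v)
  funext v
  refine Prod.ext (hc v).1 (funext fun p => ?_)
  -- The message on an out-port is recovered at the head of the edge attached to it. Since the port
  -- maps are dependent, `h2` transports along an equality of edges rather than rewriting.
  obtain ⟨⟨e, he⟩, rfl⟩ := (σ.outPort v).surjective p
  subst he
  have h1 := congrFun (hc (G.tgt e)).2 (σ.inPort (G.tgt e) ⟨e, rfl⟩)
  simp only [received] at h1
  have h2 : ∀ (x : {e' // G.tgt e' = G.tgt e}) (_ : x = ⟨e, rfl⟩),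
      (c (G.src x.1)).2 (σ.outPort (G.src x.1) ⟨x.1, rfl⟩) =
        (c' (G.src x.1)).2 (σ.outPort (G.src x.1) ⟨x.1, rfl⟩) →
      (c (G.src e)).2 (σ.outPort (G.src e) ⟨e, rfl⟩) =
        (c' (G.src e)).2 (σ.outPort (G.src e) ⟨e, rfl⟩) := by
    rintro x rfl hx; exact hx
  exact h2 _ (Equiv.symm_apply_apply _ _) h1

theorem branch_support_finite (σ : PortNumbering G) (h : List (Outcomes A N G)) :
    (Function.support (branch σ h)).Finite := by
  induction h with
  | nil =>
    refine (Set.finite_singleton (initConfig A N G)).subset fun c hc => ?_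
    by_contra hne
    exact hc (Set.indicator_of_notMem hne _)
  | cons a h ih =>
    have := (SuperOperator.sum_norm_sq_tensor (fun v => (A.prog N G v).step h.length)
      _ (received_injective σ) (branch σ h) ih).1
    exact (this.preimage (f := fun c => (a, c)) (fun _ _ _ _ h => (Prod.mk.inj h).2))

/-- The probability of a branch. -/
noncomputable def branchProb (σ : PortNumbering G) (h : List (Outcomes A N G)) : ℝ :=
  ∑ᶠ c, ‖branch σ h c‖ ^ 2

theorem successors_finite (σ : PortNumbering G) (h : List (Outcomes A N G)) :
    (Function.support fun p : Outcomes A N G × Config A N G => branch σ (p.1 :: h) p.2).Finite :=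
  (SuperOperator.sum_norm_sq_tensor (fun v => (A.prog N G v).step h.length)
      _ (received_injective σ) (branch σ h) (branch_support_finite σ h)).1

-- The type of outcomes may be infinite, but only finitely many occur after a given branch, so norm
-- preservation becomes an identity of finite sums.
open Classical in
theorem exists_sum_branchProb_cons (σ : PortNumbering G) (h : List (Outcomes A N G)) :
    ∃ s : Finset (Outcomes A N G), ∑ a ∈ s, branchProb σ (a :: h) = branchProb σ h := by
  have hfin := successors_finite σ h
  have heq := (SuperOperator.sum_norm_sq_tensor (fun v => (A.prog N G v).step h.length)
      _ (received_injective σ) (branch σ h) (branch_support_finite σ h)).2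
  refine ⟨(hfin.image Prod.fst).toFinset, ?_⟩
  rw [branchProb, ← heq]
  have hfin' : Function.HasFiniteSupport fun p : Outcomes A N G × Config A N G =>
      ‖branch σ (p.1 :: h) p.2‖ ^ 2 := by
    refine hfin.subset fun p hp => ?_
    simpa using hp
  refine Eq.trans ?_ (finsum_curry _ hfin').symm
  rw [finsum_eq_sum_of_support_subset]
  · rfl
  · intro a ha
    by_contra hcon
    apply ha
    refine finsum_eq_zero_of_forall_eq_zero fun c => ?_
    by_contra hne
    refine hcon ?_
    simp only [Set.Finite.coe_toFinset, Set.mem_image]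
    exact ⟨(a, c), by simpa using hne, rfl⟩

open Classical in
/-- Conservation of probability: the extensions of given branches together have the same
probability as these branches. -/
theorem exists_sum_branchProb_extensions (σ : PortNumbering G)
    (H : Finset (List (Outcomes A N G))) (T : ℕ) :
    ∃ U : Finset (List (Outcomes A N G)),
      (∀ h ∈ U, ∃ h₀ ∈ H, ∃ l, l.length = T ∧ h = l ++ h₀) ∧
        ∑ h ∈ U, branchProb σ h = ∑ h ∈ H, branchProb σ h := by
  induction T with
  | zero => exact ⟨H, fun h hh => ⟨h, hh, [], rfl, rfl⟩, rfl⟩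
  | succ T ih =>
    obtain ⟨U, hU, hsum⟩ := ih
    choose s hs using exists_sum_branchProb_cons (A := A) (N := N) σ
    refine ⟨(U.sigma s).image fun p => p.2 :: p.1, ?_, ?_⟩
    · intro h hh
      obtain ⟨⟨h', a⟩, hp, rfl⟩ := Finset.mem_image.1 hh
      obtain ⟨h₀, hh₀, l, hl, rfl⟩ := hU h' (Finset.mem_sigma.1 hp).1
      exact ⟨h₀, hh₀, a :: l, by simp [hl], rfl⟩
    · rw [Finset.sum_image, Finset.sum_sigma, ← hsum]
      · exact Finset.sum_congr rfl fun h _ => hs h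
      · rintro ⟨h, a⟩ - ⟨h', a'⟩ - heq
        simp only [List.cons.injEq] at heq
        obtain ⟨rfl, rfl⟩ := heq
        rfl

/-- A `finsum` with infinite support is `0` by default; this finiteness makes `outputProb` a genuine
sum, so that it can be bounded from below by partial sums. -/
theorem histories_finite (σ : PortNumbering G) (T : ℕ) :
    {p : List (Outcomes A N G) × Config A N G |
      p.1.length = T ∧ branch σ p.1 p.2 ≠ 0}.Finite := by
  induction T with
  | zero =>
    refine ((branch_support_finite (A := A) (N := N) σ []).image fun c => ([], c)).subset ?_
    rintro ⟨h, c⟩ ⟨hl, hb⟩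
    obtain rfl := List.length_eq_zero_iff.1 hl
    exact ⟨c, hb, rfl⟩
  | succ T ih =>
    refine ((ih.image Prod.fst).biUnion fun h _ =>
      (successors_finite σ h).image fun p => (p.1 :: h, p.2)).subset ?_
    rintro ⟨h, c⟩ ⟨hl, hb⟩
    obtain ⟨a, h, rfl⟩ := List.exists_cons_of_length_eq_add_one hl
    simp only [List.length_cons, Nat.add_right_cancel_iff] at hl
    have : ∃ c', branch σ h c' ≠ 0 := by
      by_contra! hcon
      exact hb (by simp [branch, hcon])
    obtain ⟨c', hc'⟩ := this
    exact Set.mem_biUnion (x := h) ⟨(h, c'), ⟨hl, hc'⟩, rfl⟩ ⟨(a, c), hb, rfl⟩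

open Classical in
theorem sum_branchProb_le_outputProb (σ : PortNumbering G) (S : Set (Fin n → LEOutput))
    (U : Finset (List (Outcomes A N G))) (hlen : ∀ h ∈ U, h.length = A.rounds N)
    (hout : ∀ h ∈ U, ∀ c, branch σ h c ≠ 0 → outputAt c ∈ S) :
    ∑ h ∈ U, branchProb σ h ≤ A.outputProb N σ S := by
  have hfin := histories_finite (A := A) (N := N) σ (A.rounds N)
  have h1 : A.outputProb N σ S = ∑ p ∈ hfin.toFinset,
      if p.1.length = A.rounds N ∧ outputAt p.2 ∈ S then ‖branch σ p.1 p.2‖ ^ 2 else 0 := by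
    rw [outputProb, ← finsum_eq_sum_of_support_subset]
    · exact finsum_congr fun p => finsum_eq_if
    · intro p hp
      simp only [Function.mem_support, ne_eq, ite_eq_right_iff, Classical.not_imp] at hp
      simpa using ⟨hp.1.1, fun h0 => hp.2 (by simp [h0])⟩
  have h2 : ∀ h ∈ U, branchProb σ h =
      ∑ c ∈ (branch_support_finite σ h).toFinset, ‖branch σ h c‖ ^ 2 := by
    intro h _
    rw [branchProb, finsum_eq_sum_of_support_subset]
    intro c hc
    simpa using hc
  rw [h1, Finset.sum_congr rfl h2, Finset.sum_sigma']
  calc _ = ∑ p ∈ (U.sigma fun h => (branch_support_finite σ h).toFinset).image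
          (fun q => (q.1, q.2)),
          if p.1.length = A.rounds N ∧ outputAt p.2 ∈ S then ‖branch σ p.1 p.2‖ ^ 2 else 0 := by
        rw [Finset.sum_image]
        · refine Finset.sum_congr rfl ?_
          rintro ⟨h, c⟩ hp
          simp only [Finset.mem_sigma, Set.Finite.mem_toFinset, Function.mem_support] at hp
          rw [if_pos ⟨hlen h hp.1, hout h hp.1 c hp.2⟩]
        · rintro ⟨h, c⟩ - ⟨h', c'⟩ - heq
          simp only [Prod.mk.injEq] at heq
          obtain ⟨rfl, rfl⟩ := heq
          rfl
    _ ≤ _ := by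
        apply Finset.sum_le_sum_of_subset_of_nonneg
        · rintro ⟨h, c⟩ hp
          obtain ⟨⟨h', c'⟩, hq, heq⟩ := Finset.mem_image.1 hp
          simp only [Prod.mk.injEq] at heq
          obtain ⟨rfl, rfl⟩ := heq
          simp only [Finset.mem_sigma, Set.Finite.mem_toFinset, Function.mem_support] at hq
          simpa using ⟨hlen _ hq.1, hq.2⟩
        · intro p _ _
          split_ifs <;> positivity

end Probability

end AnonymousQuantumAlgorithm

/-! ### Prefix codes for the messages. -/

section Codes

/-- No code word of `f` is a proper prefix of another one, and `f` is injective. -/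
def IsPrefixCode {α : Type*} (f : α → Message) : Prop :=
  ∀ a b l l', f a ++ l = f b ++ l' → a = b ∧ l = l'

theorem IsPrefixCode.injective {α : Type*} {f : α → Message} (hf : IsPrefixCode f) :
    Function.Injective f := fun a b h => (hf a b [] [] (by rw [h])).1

theorem IsPrefixCode.comp {α β : Type*} {f : α → Message} (hf : IsPrefixCode f) {g : β → α}
    (hg : Function.Injective g) : IsPrefixCode fun b => f (g b) := fun _ _ l l' h =>
  ⟨hg (hf _ _ l l' h).1, (hf _ _ l l' h).2⟩

/-- The unary code. -/
def encodeNat (k : ℕ) : Message := List.replicate k true ++ [false]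

theorem isPrefixCode_encodeNat : IsPrefixCode encodeNat := by
  intro a
  induction a with
  | zero =>
    intro b l l' h
    cases b with
    | zero => simpa [encodeNat] using h
    | succ b => simp [encodeNat, List.replicate_succ] at h
  | succ a ih =>
    intro b l l' h
    cases b with
    | zero => simp [encodeNat, List.replicate_succ] at h
    | succ b =>
      have := ih b l l' (by simpa [encodeNat, List.replicate_succ] using h)
      exact ⟨congrArg _ this.1, this.2⟩

@[simp] theorem length_encodeNat (k : ℕ) : (encodeNat k).length = k + 1 := by simp [encodeNat]

theorem isPrefixCode_singleton : IsPrefixCode fun b : Bool => [b] := by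
  intro a b l l' h
  simpa using h

theorem IsPrefixCode.prod {α β : Type*} {f : α → Message} {g : β → Message}
    (hf : IsPrefixCode f) (hg : IsPrefixCode g) :
    IsPrefixCode fun p : α × β => f p.1 ++ g p.2 := by
  rintro ⟨a, b⟩ ⟨a', b'⟩ l l' h
  simp only [List.append_assoc] at h
  obtain ⟨rfl, h₁⟩ := hf _ _ _ _ h
  obtain ⟨rfl, h₂⟩ := hg _ _ _ _ h₁
  exact ⟨rfl, h₂⟩

/-- The code words of the entries of a list, preceded by its length. -/
def encodeList {α : Type*} (f : α → Message) (L : List α) : Message :=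
  encodeNat L.length ++ L.flatMap f

theorem IsPrefixCode.list {α : Type*} {f : α → Message} (hf : IsPrefixCode f) :
    IsPrefixCode (encodeList f) := by
  have key : ∀ L L' : List α, L.length = L'.length → ∀ l l' : Message,
      L.flatMap f ++ l = L'.flatMap f ++ l' → L = L' ∧ l = l' := by
    intro L
    induction L with
    | nil =>
      intro L' hl l l' h
      obtain rfl := List.length_eq_zero_iff.1 hl.symm
      exact ⟨rfl, by simpa using h⟩
    | cons a L ih =>
      intro L' hl l l' h
      obtain ⟨a', L', rfl⟩ := List.exists_cons_of_length_eq_add_one hl.symm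
      simp only [List.flatMap_cons, List.append_assoc] at h
      obtain ⟨rfl, h₁⟩ := hf _ _ _ _ h
      obtain ⟨rfl, h₂⟩ := ih L' (by simpa using hl) _ _ h₁
      exact ⟨rfl, h₂⟩
  intro L L' l l' h
  simp only [encodeList, List.append_assoc] at h
  obtain ⟨hl, h⟩ := isPrefixCode_encodeNat _ _ _ _ h
  exact key L L' hl l l' h

theorem length_encodeList {α : Type*} (f : α → Message) (L : List α) :
    (encodeList f L).length = L.length + 1 + (L.map fun a => (f a).length).sum := by
  simp [encodeList, List.length_flatMap]

/-- Code for strings of `M` bits. -/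
def encodeBits {M : ℕ} (b : Fin M → Bool) : Message := encodeList (fun b => [b]) (List.ofFn b)

theorem isPrefixCode_encodeBits (M : ℕ) : IsPrefixCode (encodeBits (M := M)) :=
  isPrefixCode_singleton.list.comp List.ofFn_injective

@[simp] theorem length_encodeBits {M : ℕ} (b : Fin M → Bool) :
    (encodeBits b).length = 2 * M + 1 := by
  simp [encodeBits, length_encodeList, Function.comp_def, List.ofFn_const]; ring

/-- Code for an identifier, an out-port and a string of bits. -/
def encodeProbe {M : ℕ} (z : ℕ × ℕ × (Fin M → Bool)) : Message :=
  encodeNat z.1 ++ (encodeNat z.2.1 ++ encodeBits z.2.2)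

theorem isPrefixCode_encodeProbe (M : ℕ) : IsPrefixCode (encodeProbe (M := M)) :=
  isPrefixCode_encodeNat.prod (isPrefixCode_encodeNat.prod (isPrefixCode_encodeBits M))

-- The length does not depend on the values of the bits. This is what allows strings in
-- superposition to be sent, since the number of qubits has to be determined classically.
@[simp] theorem length_encodeProbe {M : ℕ} (z : ℕ × ℕ × (Fin M → Bool)) :
    (encodeProbe z).length = z.1 + z.2.1 + 2 * M + 3 := by
  simp [encodeProbe]; ring

/-- What a party knows about itself after its measurements: its identifier, its out-degree, for
each in-port the identifier and the out-port of the sender and the parity of the two bit strings,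
and the outcomes of the measurement of its own bit string. -/
@[ext]
structure Record (M : ℕ) where
  /-- the identifier -/
  ident : ℕ
  /-- the out-degree -/
  outDeg : ℕ
  /-- the senders and the parities -/
  senders : List (ℕ × ℕ × (Fin M → Bool))
  /-- the outcomes -/
  outcomes : List ℕ

/-- Code for a record. -/
def encodeRecord {M : ℕ} (ρ : Record M) : Message :=
  encodeNat ρ.ident ++ (encodeNat ρ.outDeg ++
    (encodeList encodeProbe ρ.senders ++ encodeList encodeNat ρ.outcomes))

theorem isPrefixCode_encodeRecord (M : ℕ) : IsPrefixCode (encodeRecord (M := M)) :=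
  (isPrefixCode_encodeNat.prod (isPrefixCode_encodeNat.prod
    ((isPrefixCode_encodeProbe M).list.prod isPrefixCode_encodeNat.list))).comp
      (g := fun ρ : Record M => (ρ.ident, ρ.outDeg, ρ.senders, ρ.outcomes)) <| by
    intro ρ ρ' h
    simp only [Prod.mk.injEq] at h
    exact Record.ext h.1 h.2.1 h.2.2.1 h.2.2.2

/-- Code for a finite set of records. -/
noncomputable def encodeRecords {M : ℕ} (S : Finset (Record M)) : Message :=
  encodeList encodeRecord S.toList

theorem encodeRecords_injective (M : ℕ) : Function.Injective (encodeRecords (M := M)) := by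
  intro S S' h
  have := (isPrefixCode_encodeRecord M).list.injective h
  exact Finset.coe_injective (by ext; simp [← Finset.mem_toList, this])

theorem length_encodeRecords {M : ℕ} (S : Finset (Record M)) :
    (encodeRecords S).length = S.card + 1 + ∑ ρ ∈ S, (encodeRecord ρ).length := by
  rw [encodeRecords, length_encodeList, Finset.sum_map_toList, Finset.length_toList]

/-- Decoding of a finite set of records. -/
noncomputable def decodeRecords {M : ℕ} : Message → Finset (Record M) :=
  Function.invFun encodeRecords

@[simp] theorem decodeRecords_encodeRecords {M : ℕ} (S : Finset (Record M)) :
    decodeRecords (encodeRecords S) = S :=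
  Function.leftInverse_invFun (encodeRecords_injective M) S

end Codes

/-! ### Roots of `±1` and the measurement vectors built from them. -/

section Phases

/-- The `m`-th roots of `(-1) ^ δ`, numbered by `r = 0, …, m - 1`. -/
noncomputable def phase (m δ r : ℕ) : ℂ :=
  Complex.exp (2 * Real.pi * Complex.I * ((r + δ / 2 : ℝ) / m : ℝ))

theorem norm_phase (m δ r : ℕ) : ‖phase m δ r‖ = 1 := by
  rw [phase, Complex.norm_exp]
  simp

/-- The sign does not depend on `r`: `m` parties with the same outcome contribute the same sign
whichever outcome it is. -/
theorem phase_pow (m δ r : ℕ) (hm : 0 < m) : phase m δ r ^ m = (-1) ^ δ := by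
  rw [phase, ← Complex.exp_nat_mul]
  have hm' : (m : ℂ) ≠ 0 := by exact_mod_cast hm.ne'
  have : (m : ℂ) * (2 * Real.pi * Complex.I * ((r + δ / 2 : ℝ) / m : ℝ)) =
      r * (2 * Real.pi * Complex.I) + δ * (Real.pi * Complex.I) := by
    push_cast
    field_simp
  rw [this, Complex.exp_add, Complex.exp_nat_mul_two_pi_mul_I, Complex.exp_nat_mul,
    Complex.exp_pi_mul_I, one_mul]

theorem sum_phase (m δ : ℕ) (hm : 2 ≤ m) : ∑ r : Fin m, phase m δ r = 0 := by
  have h1 : ∀ r : ℕ, phase m δ r =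
      Complex.exp (2 * Real.pi * Complex.I / m) ^ r * phase m δ 0 := by
    intro r
    rw [phase, phase, ← Complex.exp_nat_mul, ← Complex.exp_add]
    congr 1
    push_cast
    ring
  rw [Fin.sum_univ_eq_sum_range (fun r => phase m δ r) m,
    Finset.sum_congr rfl fun r _ => h1 r, ← Finset.sum_mul,
    (Complex.isPrimitiveRoot_exp m (by omega)).geom_sum_eq_zero (by omega), zero_mul]

/-- The order of the roots of unity that are used in test `q`, when there are `R` identifiers. -/
def testOrder (R q : ℕ) : ℕ := q / R + 2

/-- Whether identifier `x` is the one that is distinguished in test `q`. -/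
def testSign (R q x : ℕ) : ℕ := if q % R = x then 1 else 0

/-- Entry at the bit string `b` of the measurement vector of the party with identifier `x` for
the outcome `r`. -/
noncomputable def probeAmp (R : ℕ) {M : ℕ} (x : ℕ) (r : ∀ q : Fin M, Fin (testOrder R q))
    (b : Fin M → Bool) : ℂ :=
  ∏ q, (if b q then phase (testOrder R q) (testSign R q x) (r q) else 1) /
    (Real.sqrt (testOrder R q) : ℂ)

/-- For each test the `m` vectors `(1, ω_r) / √m` form a tight frame of the qubit space, in general
not an orthonormal basis. The diagonal entries come from `|ω_r| = 1`, the off-diagonal ones from `∑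
ω_r = 0`, which needs `m ≥ 2`. -/
theorem sum_probeAmp (R : ℕ) {M : ℕ} (x : ℕ) (b b' : Fin M → Bool) :
    ∑ r : ∀ q : Fin M, Fin (testOrder R q), star (probeAmp R x r b) * probeAmp R x r b' =
      if b = b' then 1 else 0 := by
  have h : ∀ r : ∀ q : Fin M, Fin (testOrder R q),
      star (probeAmp R x r b) * probeAmp R x r b' = ∏ q : Fin M,
        (fun (q : Fin M) (s : Fin (testOrder R q)) =>
          star (if b q then phase (testOrder R q) (testSign R q x) s else 1) *
            (if b' q then phase (testOrder R q) (testSign R q x) s else 1) /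
              (testOrder R q : ℂ)) q (r q) := by
    intro r
    rw [probeAmp, probeAmp, star_prod, ← Finset.prod_mul_distrib]
    refine Finset.prod_congr rfl fun q _ => ?_
    have hs : ((Real.sqrt (testOrder R q) : ℝ) : ℂ) * (Real.sqrt (testOrder R q) : ℝ) =
        testOrder R q := by
      rw [← Complex.ofReal_mul, Real.mul_self_sqrt (by positivity)]
      simp
    rw [star_div₀, div_mul_div_comm]
    exact congrArg _ ((congrArg (· * _) (Complex.conj_ofReal _)).trans hs)
  rw [Finset.sum_congr rfl fun r _ => h r, ← Fintype.piFinset_univ,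
    ← Finset.prod_univ_sum (fun _ => Finset.univ) fun (q : Fin M) (s : Fin (testOrder R q)) =>
      star (if b q then phase (testOrder R q) (testSign R q x) s else 1) *
        (if b' q then phase (testOrder R q) (testSign R q x) s else 1) / (testOrder R q : ℂ)]
  have hm : ∀ q : Fin M, (testOrder R q : ℂ) ≠ 0 := by
    exact fun q => Nat.cast_ne_zero.2 (by simp [testOrder])
  have hone : ∀ (m δ s : ℕ), starRingEnd ℂ (phase m δ s) * phase m δ s = 1 := by
    intro m δ s
    have := Complex.conj_mul' (phase m δ s)
    rw [norm_phase] at this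
    simpa using this
  have hq : ∀ q : Fin M, ∑ s : Fin (testOrder R q),
      star (if b q then phase (testOrder R q) (testSign R q x) s else 1) *
        (if b' q then phase (testOrder R q) (testSign R q x) s else 1) / (testOrder R q : ℂ) =
      if b q = b' q then 1 else 0 := by
    intro q
    have hsum := sum_phase (testOrder R q) (testSign R q x) (by simp [testOrder])
    have hsum' := congrArg star hsum
    rw [star_sum, star_zero] at hsum'
    rw [← Finset.sum_div]
    cases hb : b q <;> cases hb' : b' q <;> simp [hone, hm q, hsum]
    simpa using hsum'
  rw [Finset.prod_congr rfl fun q _ => hq q]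
  split_ifs with hbb
  · subst hbb; simp
  · obtain ⟨q, hne⟩ := Function.ne_iff.1 hbb
    exact Finset.prod_eq_zero (Finset.mem_univ q) (by simp [hne])

end Phases

/-! ### Operations with Kraus operators of rank one. -/

section MeasureAndPrepare

/-- The operation that performs the measurement with outcomes `a` and measurement vectors
`star (w a)` and prepares the state `φ a` if the outcome is `a`. -/
noncomputable def SuperOperator.measurePrepare {O X Y : Type} (w : O → X → ℂ) (φ : O → Y → ℂ)
    (hw : ∀ z, (Function.support fun a => w a z).Finite)
    (hdiag : ∀ z, ∑ᶠ a, star (w a z) * w a z = 1)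
    (hoff : ∀ z z', z ≠ z' → ∑ᶠ a, star (w a z) * w a z' = 0)
    (hφ : ∀ a, (Function.support (φ a)).Finite)
    (hφ' : ∀ a, ∑ᶠ y, star (φ a y) * φ a y = 1) : SuperOperator O X Y :=
  have hfin : ∀ z, {p : O × Y | w p.1 z * φ p.1 p.2 ≠ 0}.Finite := by
    intro z
    refine ((hw z).biUnion fun a _ => (hφ a).image fun y => (a, y)).subset ?_
    rintro ⟨a, y⟩ hp
    exact Set.mem_biUnion (x := a) (left_ne_zero_of_mul hp) ⟨y, right_ne_zero_of_mul hp, rfl⟩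
  -- The prepared states are unit vectors, so only the Gram matrix of the measurement vectors
  -- survives.
  have hgram : ∀ z z', ∑ᶠ p : O × Y, star (w p.1 z * φ p.1 p.2) * (w p.1 z' * φ p.1 p.2) =
      ∑ᶠ a, star (w a z) * w a z' := by
    intro z z'
    rw [finsum_curry]
    · refine finsum_congr fun a => ?_
      have h1 : ∀ y, star (w a z * φ a y) * (w a z' * φ a y) =
          star (w a z) * w a z' * (star (φ a y) * φ a y) := by
        intro y; rw [star_mul']; ring
      rw [finsum_congr h1, ← mul_finsum' _ _, hφ' a, mul_one]
      exact (hφ a).subset fun y hy => right_ne_zero_of_mul hy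
    · exact (hfin z').subset fun p hp => right_ne_zero_of_mul hp
  { kraus := fun a z y => w a z * φ a y
    finite_support := hfin
    normalized := fun z => (hgram z z).trans (hdiag z)
    orthogonal := fun z z' h => (hgram z z').trans (hoff z z' h) }

end MeasureAndPrepare

/-! ## The algorithm -/

namespace LeaderElection

section Party

variable (N R dIn dOut : ℕ)

/-- Local registers, for `N` bounding the number of parties and `R` identifiers. -/
inductive LocalState : Type where
  | start
  | superposed (x : Fin R) (b : Fin (N * R) → Bool)
  | knows (x : ℕ) (S : Finset (Record (N * R)))

/-- The local register and the incoming messages. -/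
abbrev Input : Type := LocalState N R × (Fin dIn → Message)

/-- Measurement outcomes of a party. -/
inductive Event : Type where
  | pick (x : Fin R)
  | probe (x : Fin R) (src : Fin dIn → ℕ × ℕ × (Fin (N * R) → Bool))
      (r : ∀ q : Fin (N * R), Fin (testOrder R q))
  | see (z : Input N R dIn)

variable {N R dIn dOut}

/-- Adds the bit string `b` to a received one. -/
def shiftBits {M : ℕ} (b : Fin M → Bool) (z : ℕ × ℕ × (Fin M → Bool)) :
    ℕ × ℕ × (Fin M → Bool) :=
  (z.1, z.2.1, fun q => xor (z.2.2 q) (b q))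

/-- The input of the party with identifier `x` and bit string `b`, when the received bit strings
differ from `b` as given by `src`. -/
def probeInput (x : Fin R) (src : Fin dIn → ℕ × ℕ × (Fin (N * R) → Bool))
    (b : Fin (N * R) → Bool) : Input N R dIn :=
  (.superposed x b, fun j => encodeProbe (shiftBits b (src j)))

/-- The input in round `0`. -/
def startInput : Input N R dIn := (.start, fun _ => [])

/-- The classical knowledge of a party after a measurement. -/
noncomputable def Event.knowledge (dOut : ℕ) : Event N R dIn → ℕ × Finset (Record (N * R))
  | .pick x => (x, ∅)
  | .probe x src r => (x, {⟨x, dOut, List.ofFn src, List.ofFn fun q => (r q : ℕ)⟩})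
  | .see (.knows x S, m) => by
      classical exact (x, S ∪ Finset.univ.biUnion fun j => decodeRecords (m j))
  | .see _ => (0, ∅)

open Classical in
/-- The measurement vectors of round `t`. -/
noncomputable def weight : ℕ → Event N R dIn → Input N R dIn → ℂ
  | 0, .pick _, z => if z = startInput then 1 / (Real.sqrt R : ℂ) else 0
  -- Inputs that never arise in this round are measured in the computational basis, only to complete
  -- the measurement; likewise in round 1.
  | 0, .see z', z => if z' = z ∧ z ≠ startInput then 1 else 0
  | 1, .probe x src r, z => ∑ b, if z = probeInput x src b then probeAmp R x r b else 0
  | 1, .see z', z => if z' = z ∧ ∀ x src b, z ≠ probeInput x src b then 1 else 0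
  | _ + 2, .see z', z => if z' = z then 1 else 0
  | _, _, _ => 0

/-- The register and the messages after a round in which the bit string `b` was prepared. -/
def pickOutput (dOut : ℕ) (x : Fin R) (b : Fin (N * R) → Bool) :
    LocalState N R × (Fin dOut → Message) :=
  (.superposed x b, fun p => encodeProbe (x, p, b))

/-- The register and the messages of a party with the given knowledge. -/
noncomputable def knowOutput (dOut : ℕ) (k : ℕ × Finset (Record (N * R))) :
    LocalState N R × (Fin dOut → Message) :=
  (.knows k.1 k.2, fun _ => encodeRecords k.2)

open Classical in
/-- The state prepared after a measurement. -/
noncomputable def prepared (dOut : ℕ) :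
    Event N R dIn → LocalState N R × (Fin dOut → Message) → ℂ
  | .pick x, y => if ∃ b, y = pickOutput dOut x b then
      ((Real.sqrt (2 ^ (N * R)))⁻¹ : ℝ) else 0
  | a, y => if y = knowOutput dOut (a.knowledge dOut) then 1 else 0

/-- The number of qubits sent. -/
noncomputable def messageLength (dOut : ℕ) : Event N R dIn → Fin dOut → ℕ
  | .pick x, p => x + p + 2 * (N * R) + 3
  | a, _ => (encodeRecords (a.knowledge dOut).2).length

open Classical in
theorem finsum_eq_sum_comp {α β M : Type*} [AddCommMonoid M] [Fintype β] {g : β → α}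
    (hg : Function.Injective g) {f : α → M} (hf : ∀ a, f a ≠ 0 → a ∈ Set.range g) :
    ∑ᶠ a, f a = ∑ b, f (g b) := by
  rw [← finsum_eq_sum_of_fintype, ← finsum_mem_range hg]
  exact finsum_congr fun a => by
    rw [finsum_eq_if]
    split_ifs with h
    · rfl
    · by_contra hne
      exact h (hf a hne)

theorem pickOutput_injective (x : Fin R) :
    Function.Injective (pickOutput (N := N) dOut x) := by
  intro b b' h
  simp only [pickOutput, Prod.mk.injEq, LocalState.superposed.injEq] at h
  exact h.1.2

theorem prepared_of_not_pick (a : Event N R dIn) (ha : ∀ x, a ≠ .pick x)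
    (y : LocalState N R × (Fin dOut → Message)) [Decidable (y = knowOutput dOut (a.knowledge dOut))] :
    prepared dOut a y = if y = knowOutput dOut (a.knowledge dOut) then 1 else 0 := by
  cases a with
  | pick x => exact absurd rfl (ha x)
  | probe x src r => simp only [prepared]; congr
  | see z => simp only [prepared]; congr

theorem eq_knowOutput_of_prepared_ne_zero {a : Event N R dIn} (ha : ∀ x, a ≠ .pick x)
    {y : LocalState N R × (Fin dOut → Message)} (h : prepared dOut a y ≠ 0) :
    y = knowOutput dOut (a.knowledge dOut) := by
  classical
  rw [prepared_of_not_pick a ha, ne_eq, ite_eq_right_iff, Classical.not_imp] at h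
  exact h.1

theorem finite_support_prepared (a : Event N R dIn) :
    (Function.support (prepared dOut a)).Finite := by
  classical
  by_cases ha : ∃ x, a = .pick x
  · obtain ⟨x, rfl⟩ := ha
    refine (Set.finite_range (pickOutput (N := N) dOut x)).subset fun y hy => ?_
    simp only [prepared, Function.mem_support, ne_eq, ite_eq_right_iff, Classical.not_imp] at hy
    obtain ⟨b, rfl⟩ := hy.1
    exact ⟨b, rfl⟩
  · push Not at ha
    refine (Set.finite_singleton (knowOutput dOut (a.knowledge dOut))).subset fun y hy => ?_
    rw [Function.mem_support, prepared_of_not_pick a ha] at hy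
    simpa using hy

theorem finsum_prepared (a : Event N R dIn) :
    ∑ᶠ y, star (prepared dOut a y) * prepared dOut a y = 1 := by
  classical
  by_cases ha : ∃ x, a = .pick x
  · obtain ⟨x, rfl⟩ := ha
    rw [finsum_eq_sum_comp (pickOutput_injective x)]
    · have h1 : ∀ b, star (prepared (dIn := dIn) dOut (.pick x) (pickOutput dOut x b)) *
          prepared (dIn := dIn) dOut (.pick x) (pickOutput (N := N) dOut x b) =
          ((2 ^ (N * R))⁻¹ : ℝ) := by
        intro b
        have : ∃ b', pickOutput (N := N) dOut x b = pickOutput dOut x b' := ⟨b, rfl⟩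
        simp only [prepared, this, if_true]
        rw [Complex.star_def, Complex.conj_ofReal, ← Complex.ofReal_mul, ← mul_inv,
          Real.mul_self_sqrt (by positivity)]
      rw [Finset.sum_congr rfl fun b _ => h1 b]
      simp
    · intro y hy
      have := right_ne_zero_of_mul hy
      simp only [prepared, ne_eq, ite_eq_right_iff, Classical.not_imp] at this
      obtain ⟨b, rfl⟩ := this.1
      exact ⟨b, rfl⟩
  · push Not at ha
    rw [finsum_eq_single _ (knowOutput dOut (a.knowledge dOut))]
    · rw [prepared_of_not_pick a ha]; simp
    · intro y hy
      rw [prepared_of_not_pick a ha, if_neg hy, mul_zero]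

theorem probeInput_injective {x x' : Fin R} {src src' : Fin dIn → ℕ × ℕ × (Fin (N * R) → Bool)}
    {b b' : Fin (N * R) → Bool} (h : probeInput x src b = probeInput x' src' b') :
    x = x' ∧ src = src' ∧ b = b' := by
  simp only [probeInput, Prod.mk.injEq, LocalState.superposed.injEq] at h
  obtain ⟨⟨rfl, rfl⟩, h⟩ := h
  refine ⟨rfl, funext fun j => ?_, rfl⟩
  have := (isPrefixCode_encodeProbe _).injective (congrFun h j)
  simp only [shiftBits, Prod.mk.injEq] at this
  refine Prod.ext this.1 (Prod.ext this.2.1 (funext fun q => ?_))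
  have := congrFun this.2.2 q
  simpa using this

theorem weight_one_probe (x x' : Fin R) (src src' : Fin dIn → ℕ × ℕ × (Fin (N * R) → Bool))
    (r : ∀ q : Fin (N * R), Fin (testOrder R q)) (b : Fin (N * R) → Bool)
    [Decidable (x' = x ∧ src' = src)] :
    weight 1 (.probe x' src' r) (probeInput x src b) =
      if x' = x ∧ src' = src then probeAmp R x r b else 0 := by
  simp only [weight]
  split_ifs with h
  · obtain ⟨rfl, rfl⟩ := h
    rw [Finset.sum_eq_single b]
    · simp
    · intro b' _ hne
      rw [if_neg fun h => hne (probeInput_injective h).2.2.symm]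
    · simp
  · refine Finset.sum_eq_zero fun b' _ => if_neg fun h' => h ?_
    exact ⟨(probeInput_injective h').1.symm, (probeInput_injective h').2.1.symm⟩

theorem weight_one_probe_of_ne (x' : Fin R) (src' : Fin dIn → ℕ × ℕ × (Fin (N * R) → Bool))
    (r : ∀ q : Fin (N * R), Fin (testOrder R q)) {z : Input N R dIn}
    (hz : ∀ x src b, z ≠ probeInput x src b) : weight 1 (.probe x' src' r) z = 0 := by
  simp only [weight]
  exact Finset.sum_eq_zero fun b' _ => if_neg (hz _ _ _)

-- Completeness of the measurement. In round 0 the start input is spread uniformly over `R`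
-- outcomes. In round 1 the inputs with fixed identifier and senders are indexed by `b`, and
-- `sum_probeAmp` applies to them. All other inputs are measured in the computational basis.
open Classical in
theorem weight_gram (hR : 0 < R) (t : ℕ) (z z' : Input N R dIn) :
    (Function.support fun a => weight t a z).Finite ∧
      ∑ᶠ a, star (weight t a z) * weight t a z' = if z = z' then 1 else 0 := by
  have hsee : Function.Injective (Event.see : Input N R dIn → Event N R dIn) :=
    fun _ _ h => Event.see.inj h
  match t with
  | 0 =>
    by_cases hz : z = startInput
    · have hrange : ∀ a, weight 0 a z ≠ 0 → a ∈ Set.range (Event.pick : Fin R → Event N R dIn) := by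
        intro a ha
        cases a with
        | pick x => exact ⟨x, rfl⟩
        | probe x src r => simp [weight] at ha
        | see z' => simp [weight, hz] at ha
      refine ⟨(Set.finite_range _).subset hrange, ?_⟩
      rw [finsum_eq_sum_comp (g := (Event.pick : Fin R → Event N R dIn))
        (fun _ _ h => Event.pick.inj h)
        (fun a ha => hrange a fun h0 => ha (by simp [h0]))]
      simp only [weight, hz, if_true]
      by_cases hz' : z' = startInput
      · simp only [hz', if_true]
        have hs : ((Real.sqrt R : ℝ) : ℂ) * (Real.sqrt R : ℝ) = R := by
          rw [← Complex.ofReal_mul, Real.mul_self_sqrt (by positivity)]; simp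
        have hR' : (R : ℂ) ≠ 0 := by exact_mod_cast hR.ne'
        simp only [one_div, star_inv₀, Complex.star_def, Complex.conj_ofReal, ← mul_inv, hs]
        simp [hR']
      · simp [hz', Ne.symm hz']
    · have hrange : ∀ a, weight 0 a z ≠ 0 → a = .see z := by
        intro a ha
        cases a with
        | pick x => simp [weight, hz] at ha
        | probe x src r => simp [weight] at ha
        | see z' =>
          simp only [weight, ne_eq, ite_eq_right_iff, Classical.not_imp] at ha
          rw [ha.1.1]
      refine ⟨(Set.finite_singleton _).subset hrange, ?_⟩
      rw [finsum_eq_single _ (.see z) fun a ha => by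
        rw [not_imp_comm.1 (hrange a) ha, star_zero, zero_mul]]
      by_cases hzz : z = z'
      · subst hzz; simp [weight, hz]
      · simp [weight, hzz]
  | 1 =>
    by_cases hz : ∃ x src b, z = probeInput x src b
    · obtain ⟨x, src, b, rfl⟩ := hz
      have hrange : ∀ a, weight 1 a (probeInput x src b) ≠ 0 →
          a ∈ Set.range (Event.probe (N := N) x src) := by
        intro a ha
        cases a with
        | pick x => simp [weight] at ha
        | probe x' src' r =>
          rw [weight_one_probe, ne_eq, ite_eq_right_iff, Classical.not_imp] at ha
          obtain ⟨⟨rfl, rfl⟩, -⟩ := ha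
          exact ⟨r, rfl⟩
        | see z' =>
          simp only [weight, ne_eq, ite_eq_right_iff, Classical.not_imp] at ha
          exact absurd rfl (ha.1.2 x src b)
      refine ⟨(Set.finite_range _).subset hrange, ?_⟩
      rw [finsum_eq_sum_comp (g := Event.probe (N := N) x src)
        (fun _ _ h => (Event.probe.inj h).2.2)
        (fun a ha => hrange a fun h0 => ha (by simp [h0]))]
      by_cases hz' : ∃ b', z' = probeInput x src b'
      · obtain ⟨b', rfl⟩ := hz'
        simp only [weight_one_probe, true_and, if_true]
        rw [sum_probeAmp]
        by_cases hb : b = b'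
        · simp [hb]
        · rw [if_neg hb, if_neg fun h => hb (probeInput_injective h).2.2]
      · push Not at hz'
        rw [if_neg (hz' b).symm]
        refine Finset.sum_eq_zero fun r _ => ?_
        have : weight 1 (.probe x src r) z' = 0 := by
          simp only [weight]
          exact Finset.sum_eq_zero fun b' _ => if_neg (hz' b')
        rw [this, mul_zero]
    · push Not at hz
      have hrange : ∀ a, weight 1 a z ≠ 0 → a = .see z := by
        intro a ha
        cases a with
        | pick x => simp [weight] at ha
        | probe x src r => exact absurd (weight_one_probe_of_ne x src r hz) ha
        | see z' =>
          simp only [weight, ne_eq, ite_eq_right_iff, Classical.not_imp] at ha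
          rw [ha.1.1]
      refine ⟨(Set.finite_singleton _).subset hrange, ?_⟩
      rw [finsum_eq_single _ (.see z) fun a ha => by
        rw [not_imp_comm.1 (hrange a) ha, star_zero, zero_mul]]
      by_cases hzz : z = z'
      · subst hzz
        simp only [weight, true_and]
        rw [if_pos hz]; simp
      · simp [weight, hzz]
  | t + 2 =>
    have hrange : ∀ a, weight (t + 2) a z ≠ 0 → a = .see z := by
      intro a ha
      cases a with
      | pick x => simp [weight] at ha
      | probe x src r => simp [weight] at ha
      | see z' =>
        simp only [weight, ne_eq, ite_eq_right_iff, Classical.not_imp] at ha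
        rw [ha.1]
    refine ⟨(Set.finite_singleton _).subset hrange, ?_⟩
    rw [finsum_eq_single _ (.see z) fun a ha => by
      rw [not_imp_comm.1 (hrange a) ha, star_zero, zero_mul]]
    simp [weight]

theorem length_eq_messageLength (a : Event N R dIn) (y : LocalState N R × (Fin dOut → Message))
    (hy : prepared dOut a y ≠ 0) (p : Fin dOut) : (y.2 p).length = messageLength dOut a p := by
  classical
  by_cases ha : ∃ x, a = .pick x
  · obtain ⟨x, rfl⟩ := ha
    simp only [prepared, ne_eq, ite_eq_right_iff, Classical.not_imp] at hy
    obtain ⟨b, rfl⟩ := hy.1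
    simp [pickOutput, messageLength]
  · push Not at ha
    rw [prepared_of_not_pick a ha, ne_eq, ite_eq_right_iff, Classical.not_imp] at hy
    obtain rfl := hy.1
    cases a with
    | pick x => exact absurd rfl (ha x)
    | probe x src r => rfl
    | see z => rfl

/-- The records could come from a network in which all identifiers are distinct: an identifier
determines the record, every out-port leads to a single in-port, and the parities are those of
bit strings attached to the identifiers. -/
def Plausible {M : ℕ} (S : Finset (Record M)) : Prop :=
  (∀ ρ ∈ S, ∀ ρ' ∈ S, ρ.ident = ρ'.ident → ρ = ρ') ∧
  (∀ ρ ∈ S, ∀ ρ' ∈ S, ∀ (j j' : ℕ) (x p : ℕ) (y y' : Fin M → Bool),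
    ρ.senders[j]? = some (x, p, y) → ρ'.senders[j']? = some (x, p, y') → ρ = ρ' ∧ j = j') ∧
  ∃ s : ℕ → Fin M → Bool, ∀ ρ ∈ S, ∀ z ∈ ρ.senders, ∀ q,
    z.2.2 q = xor (s z.1 q) (s ρ.ident q)

open Classical in
/-- The output of a party. -/
noncomputable def decision : LocalState N R → LEOutput
  | .knows x S => if Plausible S then
      (if ∀ ρ ∈ S, ρ.ident ≤ x then .leader else .follower) else .giveUp
  | _ => .giveUp

/-- The program of a party. -/
noncomputable abbrev program (N R dIn dOut : ℕ) (hR : 0 < R) : PartyProgram dIn dOut where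
  State := LocalState N R
  Outcome := Event N R dIn
  init := .start
  step t := SuperOperator.measurePrepare (weight t) (prepared dOut)
    (fun z => (weight_gram hR t z z).1)
    (fun z => by classical rw [(weight_gram hR t z z).2, if_pos rfl])
    (fun z z' h => by classical rw [(weight_gram hR t z z').2, if_neg h])
    finite_support_prepared finsum_prepared
  sentLength := messageLength dOut
  length_eq t a x y h p := length_eq_messageLength a y (right_ne_zero_of_mul h) p
  output := decision

end Party

/-- The number of identifiers. -/
def numIdents (c N : ℕ) : ℕ := N ^ 2 * c + 1

/-- The leader election algorithm with identifiers from a set of size `N ^ 2 * c + 1`. -/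
noncomputable abbrev algorithm (c : ℕ) : AnonymousQuantumAlgorithm where
  -- Two rounds produce the records; `N ≥ n` rounds suffice to flood them.
  rounds N := N + 2
  party N dIn dOut := program N (numIdents c N) dIn dOut (Nat.succ_pos _)

end LeaderElection

/-! ### The branches that occur when the network runs the algorithm. -/

namespace LeaderElection

open MultiDigraph AnonymousQuantumAlgorithm

section Network

variable {N R n : ℕ} {G : MultiDigraph n} (σ : G.PortNumbering)

/-- The senders seen by party `v`, if the parties have identifiers `x` and bit strings `b`. -/
def sendersOf (x : Fin n → Fin R) (b : Fin n → Fin (N * R) → Bool) (v : Fin n) :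
    Fin (G.inDeg v) → ℕ × ℕ × (Fin (N * R) → Bool) := fun j =>
  let e := ((σ.inPort v).symm j).1
  (x (G.src e), σ.outPort (G.src e) ⟨e, rfl⟩, fun q => xor (b (G.src e) q) (b v q))

/-- The record of party `v`. -/
def recordOf (x : Fin n → Fin R) (b : Fin n → Fin (N * R) → Bool)
    (r : Fin n → ∀ q : Fin (N * R), Fin (testOrder R q)) (v : Fin n) : Record (N * R) :=
  ⟨x v, G.outDeg v, List.ofFn (sendersOf σ x b v), List.ofFn fun q => (r v q : ℕ)⟩

open Classical in
/-- The records known to the parties after `t` rounds of flooding. -/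
noncomputable def spread {M : ℕ} (ρ : Fin n → Record M) : ℕ → Fin n → Finset (Record M)
  | 0, v => {ρ v}
  | t + 1, v => spread ρ t v ∪
      Finset.univ.biUnion fun j => spread ρ t (G.src ((σ.inPort v).symm j).1)

/-- The sum of the amplitudes over the bit strings that are compatible with the parities. -/
noncomputable def interference (x : Fin n → Fin R) (b : Fin n → Fin (N * R) → Bool)
    (r : Fin n → ∀ q : Fin (N * R), Fin (testOrder R q)) : ℂ :=
  ∑ β : Fin (N * R) → Bool, ∏ v, probeAmp R (x v) (r v) fun q => xor (b v q) (β q)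

/-- Reading the list of senders edge by edge hides the dependent types of the ports; all later
arguments about senders go through this form. -/
theorem getElem?_ofFn_sendersOf (x : Fin n → Fin R) (b : Fin n → Fin (N * R) → Bool)
    (e : Fin G.numEdges) :
    (List.ofFn (sendersOf σ x b (G.tgt e)))[(σ.inPort (G.tgt e) ⟨e, rfl⟩ : ℕ)]? =
      some ((x (G.src e) : ℕ), (σ.outPort (G.src e) ⟨e, rfl⟩ : ℕ),
        fun q => xor (b (G.src e) q) (b (G.tgt e) q)) := by
  rw [List.getElem?_ofFn, dif_pos (σ.inPort (G.tgt e) ⟨e, rfl⟩).2]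
  have : ∀ z : {e' // G.tgt e' = G.tgt e}, z = ⟨e, rfl⟩ →
      ((x (G.src z.1) : ℕ), ((σ.outPort (G.src z.1) ⟨z.1, rfl⟩ : Fin _) : ℕ),
        fun q => xor (b (G.src z.1) q) (b (G.tgt e) q)) =
      ((x (G.src e) : ℕ), ((σ.outPort (G.src e) ⟨e, rfl⟩ : Fin _) : ℕ),
        fun q => xor (b (G.src e) q) (b (G.tgt e) q)) := by
    rintro z rfl; rfl
  exact congrArg some (this _ (Equiv.symm_apply_apply _ _))

/-- A function that does not change along edges is constant. -/
theorem _root_.MultiDigraph.StronglyConnected.eq_of_edges {α : Type*}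
    (hG : G.StronglyConnected) (f : Fin n → α) (hf : ∀ e, f (G.src e) = f (G.tgt e))
    (u v : Fin n) : f u = f v := by
  induction hG u v with
  | refl => rfl
  | tail _ h ih =>
    obtain ⟨e, rfl, rfl⟩ := h
    exact ih.trans (hf e)

variable {c : ℕ}

/-- Rank-one Kraus operators reset the network to a product of prepared states; the past survives
only in the scalar in front, which is where interference takes place. -/
theorem branch_cons (h : List (Outcomes (algorithm c) N G)) (a : Outcomes (algorithm c) N G)
    (y : Config (algorithm c) N G) :
    branch σ (a :: h) y =
      (∑ᶠ z, branch σ h z * ∏ v, weight h.length (a v) ((z v).1, received σ z v)) *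
        ∏ v, prepared (G.outDeg v) (a v) (y v) := by
  rw [finsum_mul' _ _ ((branch_support_finite σ h).subset fun z hz => left_ne_zero_of_mul hz)]
  refine finsum_congr fun z => ?_
  rw [mul_assoc, ← Finset.prod_mul_distrib]
  rfl

theorem branch_singleton (a : Outcomes (algorithm c) N G) (y : Config (algorithm c) N G) :
    branch σ [a] y = (∏ v, weight 0 (a v) startInput) *
      ∏ v, prepared (G.outDeg v) (a v) (y v) := by
  rw [branch_cons]
  congr 1
  rw [finsum_eq_single _ (initConfig (algorithm c) N G)]
  · rw [branch, Set.indicator_of_mem (Set.mem_singleton _), Pi.one_apply, one_mul]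
    rfl
  · intro z hz
    have h0 : branch σ [] z = 0 := Set.indicator_of_notMem (s := {initConfig (algorithm c) N G}) hz _
    rw [h0, zero_mul]

theorem eq_pick_of_weight_zero {d : ℕ} {a : Event N R d} (h : weight 0 a startInput ≠ 0) :
    ∃ x, a = .pick x := by
  cases a with
  | pick x => exact ⟨x, rfl⟩
  | probe x src r => simp [weight] at h
  | see z => simp [weight] at h

theorem exists_pick_of_branch_ne_zero {a : Outcomes (algorithm c) N G}
    {y : Config (algorithm c) N G} (h : branch σ [a] y ≠ 0) :
    ∃ x : Fin n → Fin (numIdents c N), a = fun v => Event.pick (x v) := by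
  rw [branch_singleton] at h
  have := Finset.prod_ne_zero_iff.1 (left_ne_zero_of_mul h)
  choose x hx using fun v => eq_pick_of_weight_zero (this v (Finset.mem_univ v))
  exact ⟨x, funext hx⟩

/-- The configuration in which the parties have identifiers `x` and bit strings `b`. -/
def pickConfig (x : Fin n → Fin (numIdents c N))
    (b : Fin n → Fin (N * numIdents c N) → Bool) : Config (algorithm c) N G :=
  fun v => pickOutput (G.outDeg v) (x v) (b v)

theorem pickConfig_injective (x : Fin n → Fin (numIdents c N)) :
    Function.Injective (pickConfig (G := G) x) :=
  fun _ _ h => funext fun v => pickOutput_injective (x v) (congrFun h v)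

theorem input_pickConfig (x : Fin n → Fin (numIdents c N))
    (b : Fin n → Fin (N * numIdents c N) → Bool) (v : Fin n) :
    ((pickConfig (G := G) x b v).1, received σ (pickConfig (G := G) x b) v) =
      probeInput (x v) (sendersOf σ x b v) (b v) := by
  refine Prod.ext rfl (funext fun j => ?_)
  simp only [received, pickConfig, pickOutput, probeInput, sendersOf, shiftBits]
  congr 3
  funext q
  simp

/-- The amplitude of each configuration with given identifiers after round `0`. -/
noncomputable def pickAmp (N R n : ℕ) : ℂ :=
  (1 / (Real.sqrt R : ℂ)) ^ n * (((Real.sqrt (2 ^ (N * R)))⁻¹ : ℝ) : ℂ) ^ n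

open Classical in
theorem branch_pick (x : Fin n → Fin (numIdents c N)) (y : Config (algorithm c) N G) :
    branch σ [fun v => Event.pick (x v)] y =
      if ∃ b, y = pickConfig x b then pickAmp N (numIdents c N) n else 0 := by
  rw [branch_singleton]
  split_ifs with h
  · obtain ⟨b, rfl⟩ := h
    have h1 : ∀ v, weight (N := N) (dIn := G.inDeg v) 0 (.pick (x v)) startInput =
        1 / (Real.sqrt (numIdents c N) : ℂ) := fun v => by simp [weight]
    have h2 : ∀ v, prepared (dIn := G.inDeg v) (G.outDeg v) (.pick (x v))
        (pickConfig (G := G) x b v) = (((Real.sqrt (2 ^ (N * numIdents c N)))⁻¹ : ℝ) : ℂ) :=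
      fun v => by
        simp only [prepared]
        exact if_pos ⟨b v, rfl⟩
    simp only [h1, h2, Finset.prod_const, Finset.card_univ, Fintype.card_fin, pickAmp]
  · by_contra hne
    have h1 := Finset.prod_ne_zero_iff.1 (right_ne_zero_of_mul hne)
    have h2 : ∀ v, ∃ b, y v = pickOutput (G.outDeg v) (x v) b := by
      intro v
      have := h1 v (Finset.mem_univ v)
      simp only [prepared, ne_eq, ite_eq_right_iff, Classical.not_imp] at this
      exact this.1
    choose b hb using h2
    exact h ⟨b, funext hb⟩

theorem eq_probe_of_weight_one {d : ℕ} {a : Event N R d} {x : Fin R}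
    {src : Fin d → ℕ × ℕ × (Fin (N * R) → Bool)} {b : Fin (N * R) → Bool}
    (h : weight 1 a (probeInput x src b) ≠ 0) : ∃ r, a = .probe x src r := by
  classical
  cases a with
  | pick x => simp [weight] at h
  | probe x' src' r =>
    rw [weight_one_probe, ne_eq, ite_eq_right_iff, Classical.not_imp] at h
    obtain ⟨⟨rfl, rfl⟩, -⟩ := h
    exact ⟨r, rfl⟩
  | see z' =>
    simp only [weight, ne_eq, ite_eq_right_iff, Classical.not_imp] at h
    exact absurd rfl (h.1.2 x src b)

/-- The scalar in `branch_cons` is a sum over all assignments of bit strings. The observed parities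
restrict it to the shifts of one assignment `b`, and what remains is `interference` up to the common
amplitude `κ`. -/
theorem exists_probe_of_branch_ne_zero (hn : 0 < n) (hG : G.StronglyConnected)
    {x : Fin n → Fin (numIdents c N)} {a : Outcomes (algorithm c) N G}
    {y : Config (algorithm c) N G} (h : branch σ [a, fun v => Event.pick (x v)] y ≠ 0) :
    ∃ b r, interference x b r ≠ 0 ∧ a = fun v => Event.probe (x v) (sendersOf σ x b v) (r v) := by
  classical
  rw [branch_cons] at h
  have hκ := branch_pick (G := G) σ x
  set κ := pickAmp N (numIdents c N) n
  have h1 := left_ne_zero_of_mul h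
  rw [finsum_eq_sum_comp (pickConfig_injective (G := G) x)] at h1
  swap
  · intro z hz
    have := left_ne_zero_of_mul hz
    rw [hκ, ne_eq, ite_eq_right_iff, Classical.not_imp] at this
    obtain ⟨b, rfl⟩ := this.1
    exact ⟨b, rfl⟩
  have hκ' : ∀ b, branch σ [fun v => Event.pick (x v)] (pickConfig (G := G) x b) = κ :=
    fun b => by rw [hκ, if_pos ⟨b, rfl⟩]
  have hsum : ∑ b, branch σ [fun v => Event.pick (x v)] (pickConfig (G := G) x b) *
      ∏ v, weight 1 (a v)
        ((pickConfig (G := G) x b v).1, received σ (pickConfig (G := G) x b) v) =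
      κ * ∑ b, ∏ v, weight 1 (a v) (probeInput (x v) (sendersOf σ x b v) (b v)) := by
    rw [Finset.mul_sum]
    refine Finset.sum_congr rfl fun b _ => ?_
    rw [hκ']
    exact congrArg _ (Finset.prod_congr rfl fun v _ =>
      congrArg (weight 1 (a v)) (input_pickConfig σ x b v))
  replace h1 := right_ne_zero_of_mul (fun h0 => h1 (hsum.trans h0))
  obtain ⟨b, -, hb⟩ := Finset.exists_ne_zero_of_sum_ne_zero h1
  have hb' := Finset.prod_ne_zero_iff.1 hb
  choose r hr using fun v => eq_probe_of_weight_one (hb' v (Finset.mem_univ v))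
  refine ⟨b, r, ?_, funext hr⟩
  let T : (Fin (N * numIdents c N) → Bool) → Fin n → Fin (N * numIdents c N) → Bool :=
    fun β v q => xor (b v q) (β q)
  have hT : Function.Injective T := by
    intro β β' hβ
    funext q
    simpa [T] using congrFun (congrFun hβ ⟨0, hn⟩) q
  have hsenders : ∀ b' : Fin n → Fin (N * numIdents c N) → Bool,
      (∏ v, weight 1 (a v) (probeInput (x v) (sendersOf σ x b' v) (b' v)) ≠ 0 → b' ∈ Set.range T) ∧
      ((∀ v, sendersOf σ x b' v = sendersOf σ x b v) →
        ∏ v, weight 1 (a v) (probeInput (x v) (sendersOf σ x b' v) (b' v)) =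
          ∏ v, probeAmp (numIdents c N) (x v) (r v) (b' v)) := by
    intro b'
    constructor
    · intro hne
      have hv : ∀ v, sendersOf σ x b v = sendersOf σ x b' v := by
        intro v
        have := Finset.prod_ne_zero_iff.1 hne v (Finset.mem_univ v)
        rw [hr v, weight_one_probe, ne_eq, ite_eq_right_iff, Classical.not_imp] at this
        exact this.1.2
      -- Equal parities on an edge mean that the difference of `b` and `b'` does not change along
      -- it. By strong connectivity it is constant, so its value at node `0` is the shift.
      refine ⟨fun q => xor (b ⟨0, hn⟩ q) (b' ⟨0, hn⟩ q), ?_⟩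
      have hconst := hG.eq_of_edges (fun v q => xor (b v q) (b' v q)) (by
        intro e
        funext q
        have h3 := getElem?_ofFn_sendersOf σ x b e
        rw [hv, getElem?_ofFn_sendersOf σ x b' e] at h3
        simp only [Option.some.injEq, Prod.mk.injEq, true_and] at h3
        have h4 := congrFun h3 q
        revert h4
        cases b (G.src e) q <;> cases b (G.tgt e) q <;> cases b' (G.src e) q <;>
          cases b' (G.tgt e) q <;> simp) ⟨0, hn⟩
      funext v q
      have h4 := congrFun (hconst v) q
      simp only [T, h4]
      simp
    · intro heq
      refine Finset.prod_congr rfl fun v _ => ?_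
      rw [hr v, weight_one_probe, if_pos ⟨rfl, (heq v).symm⟩]
  rw [← finsum_eq_sum_of_fintype, finsum_eq_sum_comp hT fun b' => (hsenders b').1] at h1
  rw [interference]
  convert h1 using 2 with β
  · refine ((hsenders (T β)).2 fun v => ?_).symm
    funext j
    simp only [sendersOf, T, Prod.mk.injEq, true_and]
    funext q
    generalize b _ q = t; generalize b _ q = t'; generalize β q = t''
    cases t <;> cases t' <;> cases t'' <;> rfl

/-- The lengths of the messages sent by all parties in a round, when the parties know `S`. -/
noncomputable def floodLength {M : ℕ} (G : MultiDigraph n) (S : Fin n → Finset (Record M)) : ℕ :=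
  ∑ v, ∑ _p : Fin (G.outDeg v), (encodeRecords (S v)).length

/-- The lengths of the messages sent by all parties in round `0`. -/
def pickLength (N : ℕ) (G : MultiDigraph n) (x : Fin n → Fin R) : ℕ :=
  ∑ v, ∑ p : Fin (G.outDeg v), ((x v : ℕ) + p + 2 * (N * R) + 3)

/-- After round 1 everything is deterministic: a branch is governed by `x`, `b`, `r`, and the only
quantum constraint left is nonzero `interference`. Histories list the latest round first, so
`getLast?` is the choice of identifiers. -/
theorem branch_ne_zero (hn : 0 < n) (hG : G.StronglyConnected) (T : ℕ) :
    ∀ (h : List (Outcomes (algorithm c) N G)) (y : Config (algorithm c) N G),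
      h.length = T + 2 → branch σ h y ≠ 0 →
    ∃ x b r, interference x b r ≠ 0 ∧ h.getLast? = some (fun v => Event.pick (x v)) ∧
      (y = fun v => knowOutput (G.outDeg v) ((x v : ℕ), spread σ (recordOf σ x b r) T v)) ∧
      bitsSent h = pickLength N G x +
        ∑ t ∈ Finset.range (T + 1), floodLength G (spread σ (recordOf σ x b r) t) := by
  classical
  induction T with
  | zero =>
    intro h y hl hne
    obtain ⟨a₁, a₀, rfl⟩ := List.length_eq_two.1 hl
    have h0 : ∃ y₀, branch σ [a₀] y₀ ≠ 0 := by
      by_contra! hcon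
      exact hne (by simp [branch_cons, hcon])
    obtain ⟨y₀, hy₀⟩ := h0
    obtain ⟨x, rfl⟩ := exists_pick_of_branch_ne_zero σ hy₀
    obtain ⟨b, r, hint, rfl⟩ := exists_probe_of_branch_ne_zero σ hn hG hne
    refine ⟨x, b, r, hint, rfl, ?_, ?_⟩
    · rw [branch_cons] at hne
      have h1 := Finset.prod_ne_zero_iff.1 (right_ne_zero_of_mul hne)
      funext v
      have h2 := h1 v (Finset.mem_univ v)
      exact eq_knowOutput_of_prepared_ne_zero (by simp) h2
    · rw [Finset.sum_range_one, add_comm]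
      rfl
  | succ T ih =>
    intro h y hl hne
    obtain ⟨a, h, rfl⟩ := List.exists_cons_of_length_eq_add_one hl
    simp only [List.length_cons, Nat.add_right_cancel_iff] at hl
    rw [branch_cons] at hne
    have hy := Finset.prod_ne_zero_iff.1 (right_ne_zero_of_mul hne)
    obtain ⟨z, hz⟩ : ∃ z, branch σ h z *
        ∏ v, weight h.length (a v) ((z v).1, received σ z v) ≠ 0 := by
      by_contra! hcon
      exact hne (by simp [hcon])
    obtain ⟨x, b, r, hint, hlast, rfl, hbits⟩ := ih h z hl (left_ne_zero_of_mul hz)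
    have hw := Finset.prod_ne_zero_iff.1 (right_ne_zero_of_mul hz)
    have ha : ∀ v, a v = Event.see (.knows (x v) (spread σ (recordOf σ x b r) T v),
        fun j => encodeRecords (spread σ (recordOf σ x b r) T
          (G.src ((σ.inPort v).symm j).1))) := by
      intro v
      have h1 := hw v (Finset.mem_univ v)
      rw [hl] at h1
      generalize hav : a v = e at h1
      cases e with
      | pick x => simp [weight] at h1
      | probe x src r => simp [weight] at h1
      | see z' =>
        simp only [weight, ne_eq, ite_eq_right_iff, Classical.not_imp] at h1
        rw [h1.1]
        rfl
    have hknow : ∀ v, (a v).knowledge (G.outDeg v) =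
        ((x v : ℕ), spread σ (recordOf σ x b r) (T + 1) v) := by
      intro v
      rw [ha v]
      simp only [Event.knowledge, decodeRecords_encodeRecords, spread]
    refine ⟨x, b, r, hint, ?_, ?_, ?_⟩
    · rw [List.getLast?_cons, hlast]; rfl
    · funext v
      have h2 := hy v (Finset.mem_univ v)
      rw [eq_knowOutput_of_prepared_ne_zero (by simp [ha]) h2, hknow]
    · rw [Finset.sum_range_succ, ← add_assoc, ← hbits, bitsSent, add_comm]
      congr 1
      refine Finset.sum_congr rfl fun v _ => Finset.sum_congr rfl fun p _ => ?_
      rw [← show ((a v).knowledge (G.outDeg v)).2 = spread σ (recordOf σ x b r) (T + 1) v from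
        congrArg Prod.snd (hknow v)]
      show messageLength (G.outDeg v) (a v) p = _
      rw [ha v]
      rfl

end Network

end LeaderElection

/-! ### Flooding, plausible records and destructive interference. -/

namespace LeaderElection

open MultiDigraph AnonymousQuantumAlgorithm

section Combinatorics

variable {N R n : ℕ} {G : MultiDigraph n} (σ : G.PortNumbering)

theorem spread_mono {M : ℕ} (ρ : Fin n → Record M) (v : Fin n) :
    Monotone fun t => spread σ ρ t v :=
  monotone_nat_of_le_succ fun t => by
    classical
    intro z hz
    simp only [spread, Finset.mem_union]
    exact Or.inl hz

theorem spread_edge {M : ℕ} (ρ : Fin n → Record M) (t : ℕ) (e : Fin G.numEdges) :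
    spread σ ρ t (G.src e) ⊆ spread σ ρ (t + 1) (G.tgt e) := by
  classical
  intro z hz
  simp only [spread, Finset.mem_union, Finset.mem_biUnion, Finset.mem_univ, true_and]
  refine Or.inr ⟨σ.inPort (G.tgt e) ⟨e, rfl⟩, ?_⟩
  rw [Equiv.symm_apply_apply]
  exact hz

open Classical in
theorem spread_subset {M : ℕ} (ρ : Fin n → Record M) (t : ℕ) :
    ∀ v, spread σ ρ t v ⊆ Finset.univ.image ρ := by
  induction t with
  | zero => intro v; simp [spread]
  | succ t ih =>
    intro v
    simp only [spread]
    exact Finset.union_subset (ih v) (Finset.biUnion_subset.2 fun j _ => ih _)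

/-- A set of informed nodes is either closed under outgoing edges, hence everything by strong
connectivity, or some edge leaves it and the next round adds a node. -/
theorem exists_card_le_spread {M : ℕ} (hG : G.StronglyConnected) (ρ : Fin n → Record M)
    (u : Fin n) (t : ℕ) :
    ∃ D : Finset (Fin n), u ∈ D ∧ min (t + 1) n ≤ D.card ∧ ∀ v ∈ D, ρ u ∈ spread σ ρ t v := by
  classical
  induction t with
  | zero => exact ⟨{u}, by simp, by simp, by simp [spread]⟩
  | succ t ih =>
    obtain ⟨D, hu, hcard, hD⟩ := ih
    have hD' : ∀ v ∈ D, ρ u ∈ spread σ ρ (t + 1) v :=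
      fun v hv => spread_mono σ ρ v (Nat.le_succ t) (hD v hv)
    by_cases hclosed : ∀ e, G.src e ∈ D → G.tgt e ∈ D
    · have hall : ∀ v, v ∈ D := by
        intro v
        induction hG u v with
        | refl => exact hu
        | tail _ h ih =>
          obtain ⟨e, rfl, rfl⟩ := h
          exact hclosed e ih
      refine ⟨D, hu, ?_, hD'⟩
      rw [Finset.eq_univ_of_forall hall, Finset.card_univ, Fintype.card_fin]
      exact min_le_right _ _
    · push Not at hclosed
      obtain ⟨e, hsrc, htgt⟩ := hclosed
      refine ⟨insert (G.tgt e) D, Finset.mem_insert_of_mem hu, ?_, ?_⟩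
      · rw [Finset.card_insert_of_notMem htgt]
        omega
      · intro v hv
        rcases Finset.mem_insert.1 hv with rfl | hv
        · exact spread_edge σ ρ t e (hD _ hsrc)
        · exact hD' v hv

open Classical in
theorem spread_eq_image {M : ℕ} (hG : G.StronglyConnected) (ρ : Fin n → Record M) {t : ℕ}
    (ht : n ≤ t) (v : Fin n) : spread σ ρ t v = Finset.univ.image ρ := by
  refine (spread_subset σ ρ t v).antisymm fun z hz => ?_
  obtain ⟨u, -, rfl⟩ := Finset.mem_image.1 hz
  obtain ⟨D, -, hcard, hD⟩ := exists_card_le_spread σ hG ρ u t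
  have : D = Finset.univ := by
    rw [← Finset.card_eq_iff_eq_univ, Fintype.card_fin]
    have := Finset.card_le_univ D
    rw [Fintype.card_fin] at this
    omega
  exact hD v (this ▸ Finset.mem_univ v)

variable {x : Fin n → Fin R} {b : Fin n → Fin (N * R) → Bool}
  {r : Fin n → ∀ q : Fin (N * R), Fin (testOrder R q)}

open Classical in
/-- Plausible records on a network: along an edge the number of parties with the same identifier
does not decrease. -/
theorem card_ident_le (h : Plausible (Finset.univ.image (recordOf σ x b r)))
    (e : Fin G.numEdges) :
    (Finset.univ.filter fun w => x w = x (G.src e)).card ≤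
      (Finset.univ.filter fun w => x w = x (G.tgt e)).card := by
  obtain ⟨h1, h2, -⟩ := h
  have hmem : ∀ v, recordOf σ x b r v ∈ Finset.univ.image (recordOf σ x b r) :=
    fun v => Finset.mem_image_of_mem _ (Finset.mem_univ v)
  -- Equal identifiers force equal records, in particular equal out-degrees, so every such `w` has
  -- an out-port with the same number as that of `e`.
  have hex : ∀ w, x w = x (G.src e) → ∃ e', G.src e' = w ∧
      (σ.outPort (G.src e') ⟨e', rfl⟩ : ℕ) = σ.outPort (G.src e) ⟨e, rfl⟩ := by
    intro w hw
    have hrec := h1 _ (hmem w) _ (hmem (G.src e)) (congrArg Fin.val hw)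
    have hdeg : G.outDeg w = G.outDeg (G.src e) := congrArg Record.outDeg hrec
    obtain ⟨⟨e', he'⟩, hp⟩ := (σ.outPort w).surjective
      (Fin.cast hdeg.symm (σ.outPort (G.src e) ⟨e, rfl⟩))
    subst he'
    exact ⟨e', rfl, by rw [hp]; rfl⟩
  have : Nonempty (Fin G.numEdges) := ⟨e⟩
  choose! f hf1 hf2 using hex
  -- An identifier and an out-port may be listed in only one record and at only one in-port, so `f
  -- w` ends like `e`, at a party with the same record and at the same in-port number.
  have hsame : ∀ w, x w = x (G.src e) → recordOf σ x b r (G.tgt (f w)) =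
      recordOf σ x b r (G.tgt e) ∧
      (σ.inPort (G.tgt (f w)) ⟨f w, rfl⟩ : ℕ) = σ.inPort (G.tgt e) ⟨e, rfl⟩ := by
    intro w hw
    have g1 := getElem?_ofFn_sendersOf σ x b (f w)
    have g2 := getElem?_ofFn_sendersOf σ x b e
    rw [hf2 w hw, hf1 w hw, hw] at g1
    exact h2 _ (hmem _) _ (hmem _) _ _ _ _ _ _ g1 g2
  refine Finset.card_le_card_of_injOn (fun w => G.tgt (f w)) ?_ ?_
  · intro w hw
    simp only [Finset.mem_coe, Finset.mem_filter, Finset.mem_univ, true_and] at hw ⊢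
    exact Fin.ext (congrArg Record.ident (hsame w hw).1)
  · intro w hw w' hw' heq
    simp only [Finset.mem_coe, Finset.mem_filter, Finset.mem_univ, true_and] at hw hw' heq
    -- Injectivity: the target and the in-port number determine the edge, hence its source `w`.
    have hport := (hsame w hw).2.trans (hsame w' hw').2.symm
    have key : ∀ e₁ e₂ : Fin G.numEdges, G.tgt e₁ = G.tgt e₂ →
        (σ.inPort (G.tgt e₁) ⟨e₁, rfl⟩ : ℕ) = σ.inPort (G.tgt e₂) ⟨e₂, rfl⟩ → e₁ = e₂ := by
      intro e₁ e₂ htgt hp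
      have aux : ∀ (v : Fin n) (hv : G.tgt e₂ = v),
          (σ.inPort (G.tgt e₂) ⟨e₂, rfl⟩ : ℕ) = σ.inPort v ⟨e₂, hv⟩ := by
        rintro v rfl; rfl
      rw [aux _ htgt.symm] at hp
      exact congrArg Subtype.val ((σ.inPort _).injective (Fin.ext hp))
    rw [← hf1 w hw, ← hf1 w' hw', key _ _ heq hport]

/-- Each class of parties sharing an identifier contributes the `k`-th power of a single factor,
which is a sign. -/
theorem prod_pow_phase_ident {k : ℕ} (f : Fin n → ℂ) (δ : Fin R → ℕ)
    (hf : ∀ v w, x v = x w → f v = f w) (hk : ∀ v, f v ^ k = (-1) ^ δ (x v))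
    (hcard : ∀ v, (Finset.univ.filter fun w => x w = x v).card = k) :
    ∏ v, f v = ∏ i ∈ Finset.univ.image x, (-1) ^ δ i := by
  rw [← Finset.prod_fiberwise_of_maps_to (g := x) (t := Finset.univ.image x)
    fun v _ => Finset.mem_image_of_mem x (Finset.mem_univ v)]
  refine Finset.prod_congr rfl fun i hi => ?_
  obtain ⟨v, -, rfl⟩ := Finset.mem_image.1 hi
  rw [← hk v, ← hcard v, ← Finset.prod_const]
  exact Finset.prod_congr rfl fun w hw => hf w v (Finset.mem_filter.1 hw).2

/-- The bit strings that are compatible with the parities interfere destructively if every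
identifier in use is shared by the same number `k ≥ 2` of parties and determines the bit string
and the outcomes of a party. -/
theorem interference_eq_zero {k : ℕ} (hn : 0 < n) (hb : ∀ v w, x v = x w → b v = b w)
    (hr : ∀ v w, x v = x w → r v = r w) (hk : 2 ≤ k) (hkN : k ≤ N)
    (hcard : ∀ v, (Finset.univ.filter fun w => x w = x v).card = k) :
    interference x b r = 0 := by
  set v₀ : Fin n := ⟨0, hn⟩
  have hR : 0 < R := (x v₀).pos
  -- The decisive test has order `k` and distinguishes the identifier of `v₀`. Orders start at `2`,
  -- whence `k - 2`, and `k ≤ N` puts its index in range.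
  have hq₀ : (k - 2) * R + x v₀ < N * R := by
    have h1 : (k - 2) * R + R ≤ N * R := by
      rw [← Nat.succ_mul]; exact Nat.mul_le_mul_right _ (by omega)
    have := (x v₀).2
    omega
  set q₀ : Fin (N * R) := ⟨(k - 2) * R + x v₀, hq₀⟩ with hq₀def
  have horder : testOrder R q₀ = k := by
    have : ((k - 2) * R + x v₀) / R = k - 2 := by
      rw [mul_comm, Nat.mul_add_div hR, Nat.div_eq_of_lt (x v₀).2, add_zero]
    simp only [testOrder, hq₀def, this]; omega
  have hsign : ∀ i : Fin R, testSign R q₀ i = if i = x v₀ then 1 else 0 := by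
    intro i
    have : ((k - 2) * R + x v₀) % R = x v₀ := by
      rw [mul_comm, Nat.mul_add_mod, Nat.mod_eq_of_lt (x v₀).2]
    simp only [testSign, hq₀def, this]
    simp only [Fin.ext_iff, eq_comm]
  let g : ∀ q : Fin (N * R), Bool → ℂ := fun q t => ∏ v,
    (if xor (b v q) t then phase (testOrder R q) (testSign R q (x v)) (r v q) else 1) /
      (Real.sqrt (testOrder R q) : ℂ)
  -- The amplitudes are products over tests, and the shift `β` chooses its bits independently, so
  -- one vanishing factor suffices.
  have hfactor : interference x b r = ∏ q, ∑ t, g q t := by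
    rw [interference, Finset.prod_univ_sum, Fintype.piFinset_univ]
    refine Finset.sum_congr rfl fun β _ => ?_
    simp only [probeAmp, g]
    rw [Finset.prod_comm]
  rw [hfactor]
  refine Finset.prod_eq_zero (Finset.mem_univ q₀) ?_
  -- Only the class of `v₀` can contribute `-1`, and it does so for exactly one value of the shift
  -- bit `t`; the two terms cancel.
  have hval : ∀ t, g q₀ t = (if xor (b v₀ q₀) t then -1 else 1) /
      (Real.sqrt (testOrder R q₀) : ℂ) ^ n := by
    intro t
    simp only [g]
    rw [Finset.prod_div_distrib, Finset.prod_const, Finset.card_univ, Fintype.card_fin]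
    congr 1
    rw [prod_pow_phase_ident (x := x) (k := k) _
      (fun i => if i = x v₀ then (if xor (b v₀ q₀) t then 1 else 0) else 0)]
    · rw [Finset.prod_eq_single (x v₀)]
      · simp only [if_true]; split_ifs <;> simp
      · intro i _ hi; simp [hi]
      · intro h; exact absurd (Finset.mem_image_of_mem x (Finset.mem_univ v₀)) h
    · intro v w hvw
      rw [hb v w hvw, hr v w hvw, hvw]
    · intro v
      by_cases hv : x v = x v₀
      · rw [hb v v₀ hv, if_pos hv]
        split_ifs with h
        · have := phase_pow (testOrder R q₀) (testSign R q₀ (x v)) (r v q₀) (by omega)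
          rw [hsign, if_pos hv] at this
          exact (congrArg (phase _ _ _ ^ ·) horder.symm).trans (by rw [hsign, if_pos hv, this])
        · simp
      · rw [if_neg hv]
        split_ifs with h
        · have := phase_pow (testOrder R q₀) (testSign R q₀ (x v)) (r v q₀) (by omega)
          rw [hsign, if_neg hv] at this
          exact (congrArg (phase _ _ _ ^ ·) horder.symm).trans (by rw [hsign, if_neg hv, this])
        · simp
    · exact hcard
  rw [Fintype.sum_bool, hval, hval]
  cases b v₀ q₀ <;> simp [neg_div]

-- Class sizes are monotone along edges, so strong connectivity makes them all equal to some `k ≤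
-- N`. Plausibility supplies the symmetry required by `interference_eq_zero`, which rules out `k ≥
-- 2`.
open Classical in
theorem injective_of_plausible (hn : 0 < n) (hnN : n ≤ N) (hG : G.StronglyConnected)
    (h : Plausible (Finset.univ.image (recordOf σ x b r))) (hint : interference x b r ≠ 0) :
    Function.Injective x := by
  have hmem : ∀ v, recordOf σ x b r v ∈ Finset.univ.image (recordOf σ x b r) :=
    fun v => Finset.mem_image_of_mem _ (Finset.mem_univ v)
  set K : Fin n → ℕ := fun v => (Finset.univ.filter fun w => x w = x v).card with hK
  have hKle : ∀ u v, K u ≤ K v := by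
    intro u v
    induction hG u v with
    | refl => exact le_rfl
    | tail _ he ih =>
      obtain ⟨e, rfl, rfl⟩ := he
      exact ih.trans (card_ident_le σ h e)
  obtain ⟨k, hk⟩ : ∃ k, ∀ v, K v = k := ⟨K ⟨0, hn⟩, fun v => (hKle _ _).antisymm (hKle _ _)⟩
  have hkn : k ≤ n :=
    (hk ⟨0, hn⟩).symm.le.trans ((Finset.card_le_univ _).trans (Fintype.card_fin n).le)
  by_cases hk2 : 2 ≤ k
  · refine absurd (interference_eq_zero hn ?_ ?_ hk2 (hkn.trans hnN) ?_) hint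
    · obtain ⟨-, -, s, hs⟩ := h
      intro v w hvw
      -- The strings `s` explain all parities, so `b v` and `s (x v)` differ by a shift common to
      -- all parties. Hence `b v` depends on `x v` only.
      have hconst := hG.eq_of_edges (fun v q => xor (b v q) (s (x v) q)) fun e => by
        funext q
        have := hs _ (hmem (G.tgt e)) _
          (List.mem_of_getElem? (getElem?_ofFn_sendersOf σ x b e)) q
        simp only [recordOf] at this
        revert this
        cases b (G.src e) q <;> cases b (G.tgt e) q <;> cases s (x (G.src e)) q <;>
          cases s (x (G.tgt e)) q <;> simp
      funext q
      have := congrFun (hconst v w) q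
      simp only [hvw] at this
      simpa using this
    · intro v w hvw
      have := congrArg Record.outcomes (h.1 _ (hmem v) _ (hmem w) (congrArg Fin.val hvw))
      funext q
      exact Fin.ext (congrFun (List.ofFn_injective this) q)
    · intro v
      rw [← hk v, hK]
  · intro v w hvw
    have h1 : K w ≤ 1 := by rw [hk]; omega
    exact Finset.card_le_one.1 h1 v (by simp [hvw]) w (by simp)

open Classical in
theorem plausible_of_injective (hx : Function.Injective x) :
    Plausible (Finset.univ.image (recordOf σ x b r)) := by
  have hident : ∀ v w, (recordOf σ x b r v).ident = (recordOf σ x b r w).ident → v = w :=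
    fun v w h => hx (Fin.ext h)
  have hsender : ∀ (v : Fin n) (j : ℕ) z, (recordOf σ x b r v).senders[j]? = some z →
      ∃ e, G.tgt e = v ∧ (σ.inPort (G.tgt e) ⟨e, rfl⟩ : ℕ) = j ∧
        z = ((x (G.src e) : ℕ), (σ.outPort (G.src e) ⟨e, rfl⟩ : ℕ),
          fun q => xor (b (G.src e) q) (b (G.tgt e) q)) := by
    intro v j z hz
    obtain ⟨hj, -⟩ := List.getElem?_eq_some_iff.1 hz
    simp only [recordOf, List.length_ofFn] at hj
    obtain ⟨⟨e, he⟩, hp⟩ := (σ.inPort v).surjective ⟨j, hj⟩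
    subst he
    have hj' : (σ.inPort (G.tgt e) ⟨e, rfl⟩ : ℕ) = j := by rw [hp]
    refine ⟨e, rfl, hj', ?_⟩
    have := getElem?_ofFn_sendersOf σ x b e
    rw [hj'] at this
    exact Option.some.inj (hz.symm.trans this)
  refine ⟨?_, ?_, ?_⟩
  · intro ρ hρ ρ' hρ' h
    obtain ⟨v, -, rfl⟩ := Finset.mem_image.1 hρ
    obtain ⟨w, -, rfl⟩ := Finset.mem_image.1 hρ'
    rw [hident v w h]
  · intro ρ hρ ρ' hρ' j j' i p y y' h h'
    obtain ⟨v, -, rfl⟩ := Finset.mem_image.1 hρ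
    obtain ⟨w, -, rfl⟩ := Finset.mem_image.1 hρ'
    obtain ⟨e, rfl, rfl, hz⟩ := hsender _ _ _ h
    obtain ⟨e', rfl, rfl, hz'⟩ := hsender _ _ _ h'
    simp only [Prod.mk.injEq] at hz hz'
    have hsrc : G.src e' = G.src e := hx (Fin.ext (hz'.1.symm.trans hz.1))
    have hp := hz'.2.1.symm.trans hz.2.1
    have aux : ∀ (v : Fin n) (hv : G.src e' = v),
        (σ.outPort (G.src e') ⟨e', rfl⟩ : ℕ) = σ.outPort v ⟨e', hv⟩ := by
      rintro v rfl; rfl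
    rw [aux _ hsrc] at hp
    obtain rfl : e' = e := congrArg Subtype.val ((σ.outPort _).injective (Fin.ext hp))
    exact ⟨rfl, rfl⟩
  -- The actual strings explain the parities once they are indexed by identifiers; unused
  -- identifiers get the zero string.
  · refine ⟨fun i q => if h : ∃ v, (x v : ℕ) = i then b h.choose q else false, ?_⟩
    have hb : ∀ v q, (if h : ∃ w, (x w : ℕ) = x v then b h.choose q else false) = b v q := by
      intro v q
      have hex : ∃ w, (x w : ℕ) = x v := ⟨v, rfl⟩
      rw [dif_pos hex, hx (Fin.ext hex.choose_spec)]
    intro ρ hρ z hz q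
    obtain ⟨v, -, rfl⟩ := Finset.mem_image.1 hρ
    obtain ⟨j, hj⟩ := List.mem_iff_getElem?.1 hz
    obtain ⟨e, rfl, -, rfl⟩ := hsender _ _ _ hj
    exact (congrArg₂ xor (hb _ q) (hb _ q)).symm

end Combinatorics

end LeaderElection

/-! ### Zero error and the success probability. -/

namespace LeaderElection

open MultiDigraph AnonymousQuantumAlgorithm

section Correctness

variable {c N n : ℕ} {G : MultiDigraph n} (σ : G.PortNumbering)

theorem outputAt_mem_uniqueLeader (hn : 0 < n) (hnN : n ≤ N) (hG : G.StronglyConnected)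
    {x : Fin n → Fin (numIdents c N)} {b : Fin n → Fin (N * numIdents c N) → Bool}
    {r : Fin n → ∀ q : Fin (N * numIdents c N), Fin (testOrder (numIdents c N) q)}
    (hx : Function.Injective x) :
    (outputAt (A := algorithm c) (N := N) (G := G)
      fun v => knowOutput (G.outDeg v) ((x v : ℕ), spread σ (recordOf σ x b r) N v)) ∈
        uniqueLeader n := by
  classical
  have hpl := plausible_of_injective σ (b := b) (r := r) hx
  have : Nonempty (Fin n) := ⟨⟨0, hn⟩⟩
  obtain ⟨k, hk⟩ := Finite.exists_max x
  have hout : ∀ v, outputAt (A := algorithm c) (N := N) (G := G)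
      (fun v => knowOutput (G.outDeg v) ((x v : ℕ), spread σ (recordOf σ x b r) N v)) v =
        if ∀ w, x w ≤ x v then .leader else .follower := by
    intro v
    have h1 : (∀ ρ ∈ Finset.univ.image (recordOf σ x b r), ρ.ident ≤ x v) ↔
        ∀ w, x w ≤ x v := by
      simp only [Finset.mem_image, Finset.mem_univ, true_and, forall_exists_index,
        forall_apply_eq_imp_iff]
      rfl
    show decision (.knows (x v : ℕ) (spread σ (recordOf σ x b r) N v)) = _
    simp only [decision, spread_eq_image σ hG _ hnN]
    rw [if_pos hpl]
    exact if_congr h1 rfl rfl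
  refine ⟨k, by rw [hout, if_pos hk], fun i hi => ?_⟩
  rw [hout, if_neg]
  intro hmax
  exact hi (hx ((hk i).antisymm (hmax k)))

/-- All parties hold the full set of records after flooding, so they agree on whether it is
plausible; if it is, the identifiers are distinct. -/
theorem mem_uniqueLeader_or_eq_allGiveUp (hn : 0 < n) (hnN : n ≤ N) (hG : G.StronglyConnected)
    {h : List (Outcomes (algorithm c) N G)} {y : Config (algorithm c) N G}
    (hl : h.length = N + 2) (hne : branch σ h y ≠ 0) :
    outputAt y ∈ uniqueLeader n ∨ outputAt y = allGiveUp n := by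
  classical
  obtain ⟨x, b, r, hint, -, rfl, -⟩ := branch_ne_zero σ hn hG N h y hl hne
  by_cases hpl : Plausible (Finset.univ.image (recordOf σ x b r))
  · exact Or.inl (outputAt_mem_uniqueLeader σ hn hnN hG
      (injective_of_plausible σ hn hnN hG hpl hint))
  · refine Or.inr (funext fun v => ?_)
    show decision (.knows (x v : ℕ) (spread σ (recordOf σ x b r) N v)) = _
    simp only [decision, spread_eq_image σ hG _ hnN]
    rw [if_neg hpl]
    rfl

theorem mem_uniqueLeader_of_injective (hn : 0 < n) (hnN : n ≤ N) (hG : G.StronglyConnected)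
    {l : List (Outcomes (algorithm c) N G)} {y : Config (algorithm c) N G}
    {x : Fin n → Fin (numIdents c N)} (hx : Function.Injective x) (hl : l.length = N + 1)
    (hne : branch σ (l ++ [fun v => Event.pick (x v)]) y ≠ 0) :
    outputAt y ∈ uniqueLeader n := by
  obtain ⟨x', b, r, -, hlast, rfl, -⟩ :=
    branch_ne_zero σ hn hG N _ y (by simp [hl]) hne
  have hxx : x = x' := by
    have h1 : (l ++ [fun v => Event.pick (x v)]).getLast? =
        some (fun v => Event.pick (x v) : Outcomes (algorithm c) N G) := List.getLast?_concat
    have h2 := Option.some.inj (h1.symm.trans hlast)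
    funext v
    exact Event.pick.inj (congrFun h2 v)
  subst hxx
  exact outputAt_mem_uniqueLeader σ hn hnN hG hx

theorem branchProb_pick (x : Fin n → Fin (numIdents c N)) :
    branchProb (A := algorithm c) (N := N) σ [fun v => Event.pick (x v)] =
      ((numIdents c N : ℝ) ^ n)⁻¹ := by
  classical
  rw [branchProb, finsum_eq_sum_comp (pickConfig_injective (G := G) x)]
  · have h1 : ∀ b, branch (A := algorithm c) (N := N) σ [fun v => Event.pick (x v)]
        (pickConfig x b) = pickAmp N (numIdents c N) n := by
      intro b
      rw [branch_pick, if_pos ⟨b, rfl⟩]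
    have h2 : ‖pickAmp N (numIdents c N) n‖ ^ 2 =
        ((numIdents c N : ℝ) ^ n)⁻¹ * (((2 : ℝ) ^ (N * numIdents c N)) ^ n)⁻¹ := by
      rw [pickAmp, norm_mul, norm_pow, norm_pow, norm_div, norm_one, Complex.norm_real,
        Complex.norm_real, norm_inv, Real.norm_of_nonneg (Real.sqrt_nonneg _),
        Real.norm_of_nonneg (Real.sqrt_nonneg _), one_div, mul_pow, ← pow_mul, ← pow_mul,
        mul_comm n 2, pow_mul, pow_mul, inv_pow _ 2, inv_pow _ 2,
        Real.sq_sqrt (Nat.cast_nonneg _), Real.sq_sqrt (by positivity), inv_pow, inv_pow]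
    simp only [h1, h2, Finset.sum_const, Finset.card_univ, Fintype.card_fun, Fintype.card_bool,
      Fintype.card_fin, nsmul_eq_mul, Nat.cast_pow, Nat.cast_ofNat]
    field_simp
  · intro y hy
    have : branch (A := algorithm c) (N := N) σ [fun v => Event.pick (x v)] y ≠ 0 := by
      intro h0; exact hy (by simp [h0])
    rw [branch_pick, ne_eq, ite_eq_right_iff, Classical.not_imp] at this
    obtain ⟨b, rfl⟩ := this.1
    exact ⟨b, rfl⟩

open Classical in
theorem card_filter_injective (n R : ℕ) :
    (Finset.univ.filter fun x : Fin n → Fin R => Function.Injective x).card =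
      R.descFactorial n := by
  rw [← Fintype.card_subtype, Fintype.card_congr (Equiv.subtypeInjectiveEquivEmbedding _ _),
    Fintype.card_embedding_eq, Fintype.card_fin, Fintype.card_fin]

/-- The birthday bound: the falling factorial is at least `(R - n) ^ n`, and Bernoulli's inequality
applies to `(1 - n / R) ^ n`. -/
theorem one_sub_le_descFactorial_div {n R : ℕ} (hR : 0 < R) (hnR : n ≤ R) :
    1 - (n : ℝ) ^ 2 / R ≤ R.descFactorial n * ((R : ℝ) ^ n)⁻¹ := by
  have hR' : (0 : ℝ) < R := by exact_mod_cast hR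
  have hnR' : (n : ℝ) / R ≤ 1 := by
    rw [div_le_one hR']; exact_mod_cast hnR
  have h1 : 1 + (n : ℝ) * (-(n / R)) ≤ (1 + -((n : ℝ) / R)) ^ n :=
    one_add_mul_le_pow (by linarith) n
  have h2 : (1 + -((n : ℝ) / R)) ^ n = ((R : ℝ) - n) ^ n * ((R : ℝ) ^ n)⁻¹ := by
    rw [← inv_pow, ← mul_pow]
    congr 1
    field_simp
    ring
  have h3 : ((R : ℝ) - n) ^ n ≤ R.descFactorial n := by
    rw [← Nat.cast_sub hnR]
    exact_mod_cast (Nat.pow_le_pow_left (by omega) n).trans (Nat.pow_sub_le_descFactorial R n)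
  calc 1 - (n : ℝ) ^ 2 / R = 1 + (n : ℝ) * (-(n / R)) := by ring
    _ ≤ ((R : ℝ) - n) ^ n * ((R : ℝ) ^ n)⁻¹ := h1.trans h2.le
    _ ≤ _ := by gcongr

/-- The branches that start with distinct identifiers keep their total probability when extended to
the last round, and each of them ends with a unique leader. -/
theorem one_sub_le_outputProb (hn : 0 < n) (hnN : n ≤ N) (hG : G.StronglyConnected)
    (hc : 0 < c) : 1 - 1 / (c : ℝ) ≤ (algorithm c).outputProb N σ (uniqueLeader n) := by
  classical
  have hNN : n ≤ numIdents c N := by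
    rw [numIdents]
    nlinarith [Nat.mul_le_mul hnN hnN, Nat.mul_le_mul_left (N ^ 2) hc, Nat.le_self_pow two_ne_zero N]
  set H : Finset (List (Outcomes (algorithm c) N G)) :=
    (Finset.univ.filter fun x : Fin n → Fin (numIdents c N) => Function.Injective x).image
      fun x => [fun v => Event.pick (x v)] with hH
  obtain ⟨U, hU, hsum⟩ := exists_sum_branchProb_extensions σ H (N + 1)
  have hU' : ∀ h ∈ U, ∃ (x : Fin n → Fin (numIdents c N))
      (l : List (Outcomes (algorithm c) N G)), Function.Injective x ∧
      l.length = N + 1 ∧ h = l ++ [fun v => Event.pick (x v)] := by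
    intro h hh
    obtain ⟨h₀, hh₀, l, hl, rfl⟩ := hU h hh
    obtain ⟨x, hx, rfl⟩ := Finset.mem_image.1 hh₀
    exact ⟨x, l, (Finset.mem_filter.1 hx).2, hl, rfl⟩
  have hle := sum_branchProb_le_outputProb σ (uniqueLeader n) U
    (fun h hh => by
      obtain ⟨x, l, -, hl, rfl⟩ := hU' h hh
      simp [hl])
    (fun h hh y hy => by
      obtain ⟨x, l, hx, hl, rfl⟩ := hU' h hh
      exact mem_uniqueLeader_of_injective σ hn hnN hG hx hl hy)
  refine le_trans ?_ hle
  rw [hsum, hH, Finset.sum_image]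
  · rw [Finset.sum_congr rfl fun x _ => branchProb_pick σ x, Finset.sum_const,
      card_filter_injective, nsmul_eq_mul]
    refine le_trans ?_ (one_sub_le_descFactorial_div (Nat.succ_pos _) hNN)
    have hc' : (0 : ℝ) < c := by exact_mod_cast hc
    have : (n : ℝ) ^ 2 / (numIdents c N : ℕ) ≤ 1 / c := by
      rw [div_le_div_iff₀ (by exact_mod_cast Nat.succ_pos _) hc', one_mul]
      have : n ^ 2 * c ≤ numIdents c N :=
        (Nat.mul_le_mul_right _ (Nat.pow_le_pow_left hnN 2)).trans (Nat.le_succ _)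
      exact_mod_cast this
    linarith
  · intro x _ x' _ h
    simp only [List.cons.injEq, and_true] at h
    funext v
    exact Event.pick.inj (congrFun h v)

end Correctness

/-! ### Communication complexity. -/

section Complexity

variable {N R n : ℕ} {G : MultiDigraph n} (σ : G.PortNumbering)

theorem sum_outDeg (G : MultiDigraph n) : ∑ v, G.outDeg v = G.numEdges := by
  simp only [outDeg, ← Fintype.card_sigma]
  rw [Fintype.card_congr (Equiv.sigmaFiberEquiv G.src), Fintype.card_fin]

theorem sum_inDeg (G : MultiDigraph n) : ∑ v, G.inDeg v = G.numEdges := by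
  simp only [inDeg, ← Fintype.card_sigma]
  rw [Fintype.card_congr (Equiv.sigmaFiberEquiv G.tgt), Fintype.card_fin]

theorem outDeg_le (G : MultiDigraph n) (v : Fin n) : G.outDeg v ≤ G.numEdges := by
  rw [← sum_outDeg]
  exact Finset.single_le_sum (f := fun v => G.outDeg v) (fun _ _ => Nat.zero_le _)
    (Finset.mem_univ v)

theorem pickLength_le (x : Fin n → Fin R) :
    pickLength N G x ≤ G.numEdges * (R + G.numEdges + 2 * (N * R) + 3) := by
  rw [pickLength, ← sum_outDeg, Finset.sum_mul]
  refine Finset.sum_le_sum fun v _ => ?_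
  have : ∀ p ∈ (Finset.univ : Finset (Fin (G.outDeg v))), (x v : ℕ) + p + 2 * (N * R) + 3 ≤
      R + ∑ v, G.outDeg v + 2 * (N * R) + 3 := by
    intro p _
    have h1 := (x v).2
    have h2 := p.2
    have h3 := outDeg_le G v
    rw [sum_outDeg]
    omega
  refine (Finset.sum_le_sum this).trans ?_
  simp

theorem length_encodeRecord_recordOf_le (x : Fin n → Fin R) (b : Fin n → Fin (N * R) → Bool)
    (r : Fin n → ∀ q : Fin (N * R), Fin (testOrder R q)) (v : Fin n) :
    (encodeRecord (recordOf σ x b r v)).length ≤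
      (R + G.numEdges + N * R * (N + 2) + 3) +
        G.inDeg v * (R + G.numEdges + 2 * (N * R) + 4) := by
  have h1 : ∑ j, (encodeProbe (sendersOf σ x b v j)).length ≤
      G.inDeg v * (R + G.numEdges + 2 * (N * R) + 3) := by
    refine (Finset.sum_le_card_nsmul _ _ (R + G.numEdges + 2 * (N * R) + 3) fun j _ => ?_).trans
      (by simp)
    rw [length_encodeProbe]
    simp only [sendersOf]
    have h1 := (x (G.src ((σ.inPort v).symm j).1)).2
    have h2 := (σ.outPort (G.src ((σ.inPort v).symm j).1) ⟨((σ.inPort v).symm j).1, rfl⟩).2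
    have h3 := outDeg_le G (G.src ((σ.inPort v).symm j).1)
    omega
  -- Since `q / R < N`, test orders are at most `N + 1`, so outcomes are at most `N` and their unary
  -- codes have at most `N + 1` bits.
  have h2 : ∑ q, (encodeNat (r v q)).length ≤ N * R * (N + 1) := by
    refine (Finset.sum_le_card_nsmul _ _ (N + 1) fun q _ => ?_).trans (by simp)
    rw [length_encodeNat]
    have h1 := (r v q).2
    have h2 : (q : ℕ) / R < N := Nat.div_lt_of_lt_mul (q.2.trans_eq (mul_comm N R))
    simp only [testOrder] at h1
    omega
  have h3 := (x v).2
  have h4 := outDeg_le G v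
  simp only [encodeRecord, recordOf, List.length_append, length_encodeNat, length_encodeList,
    List.length_ofFn, List.map_ofFn, List.sum_ofFn, Function.comp_apply]
  rw [show N * R * (N + 2) = N * R + N * R * (N + 1) by ring,
    show G.inDeg v * (R + G.numEdges + 2 * (N * R) + 4) =
      G.inDeg v + G.inDeg v * (R + G.numEdges + 2 * (N * R) + 3) by ring]
  simp only [length_encodeNat] at h2
  omega

theorem length_encodeRecords_spread_le (x : Fin n → Fin R) (b : Fin n → Fin (N * R) → Bool)
    (r : Fin n → ∀ q : Fin (N * R), Fin (testOrder R q)) (t : ℕ) (v : Fin n) :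
    (encodeRecords (spread σ (recordOf σ x b r) t v)).length ≤
      n + 1 + (n * (R + G.numEdges + N * R * (N + 2) + 3) +
        G.numEdges * (R + G.numEdges + 2 * (N * R) + 4)) := by
  classical
  rw [length_encodeRecords]
  have hsub := spread_subset σ (recordOf σ x b r) t v
  have h1 : (spread σ (recordOf σ x b r) t v).card ≤ n :=
    (Finset.card_le_card hsub).trans (Finset.card_image_le.trans (by simp))
  have h2 : ∑ ρ ∈ spread σ (recordOf σ x b r) t v, (encodeRecord ρ).length ≤
      ∑ v, (encodeRecord (recordOf σ x b r v)).length :=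
    (Finset.sum_le_sum_of_subset hsub).trans
      (Finset.sum_image_le_of_nonneg fun _ _ => Nat.zero_le _)
  have h3 := h2.trans (Finset.sum_le_sum fun v _ => length_encodeRecord_recordOf_le σ x b r v)
  rw [Finset.sum_add_distrib, ← Finset.sum_mul, sum_inDeg, Finset.sum_const, Finset.card_univ,
    Fintype.card_fin, smul_eq_mul] at h3
  omega

theorem floodLength_le {M : ℕ} (S : Fin n → Finset (Record M)) {L : ℕ}
    (hL : ∀ v, (encodeRecords (S v)).length ≤ L) : floodLength G S ≤ G.numEdges * L := by
  rw [floodLength, ← sum_outDeg, Finset.sum_mul]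
  refine Finset.sum_le_sum fun v _ => ?_
  simp only [Finset.sum_const, Finset.card_univ, Fintype.card_fin, smul_eq_mul]
  exact Nat.mul_le_mul_left _ (hL v)

/-- For fixed `c` and `K`, both `R` and the number of edges are `O(N ^ 2)`, strings have `O(N ^ 3)`
bits, and a full set of records takes `O(N ^ 5)` bits, `n * N ^ 4` for outcomes and `N ^ 2 * N ^ 3`
for senders. Sending it over all edges in `N + 1` rounds costs `O(N ^ 8)`, which leaves room below
`N ^ 9`. -/
theorem bitsSent_le {c : ℕ} (hn : 0 < n) (hnN : n ≤ N) (hG : G.StronglyConnected) {K : ℕ}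
    (hK : G.numEdges ≤ K * N ^ 2) {h : List (Outcomes (algorithm c) N G)}
    {y : Config (algorithm c) N G} (hl : h.length = N + 2) (hne : branch σ h y ≠ 0) :
    bitsSent h ≤ 43 * (c + K + 1) ^ 3 * N ^ 9 := by
  obtain ⟨x, b, r, -, -, -, hbits⟩ := branch_ne_zero σ hn hG N h y hl hne
  have h1 : bitsSent h ≤ _ := hbits.le.trans (add_le_add (pickLength_le x)
    ((Finset.sum_le_sum fun t _ => floodLength_le _
      (length_encodeRecords_spread_le σ x b r t)).trans (by
        rw [Finset.sum_const, Finset.card_range, smul_eq_mul])))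
  refine h1.trans ?_
  have hN : 1 ≤ N := hn.trans_le hnN
  set D := c + K + 1 with hD
  have hD1 : 1 ≤ D := by omega
  have hE : G.numEdges ≤ D * N ^ 2 := hK.trans (Nat.mul_le_mul_right _ (by omega))
  have hR : numIdents c N ≤ D * N ^ 2 := by
    have : 1 ≤ N ^ 2 := Nat.one_le_pow _ _ hN
    rw [numIdents]
    nlinarith [Nat.zero_le (K * N ^ 2)]
  generalize G.numEdges = E at *
  generalize numIdents c N = R at *
  have h23 : N ^ 2 ≤ N ^ 3 := Nat.pow_le_pow_right hN (by norm_num)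
  have h34 : N ^ 3 ≤ N ^ 4 := Nat.pow_le_pow_right hN (by norm_num)
  have hone : ∀ k, 1 ≤ D * N ^ k := fun k => Nat.mul_pos hD1 (Nat.one_le_pow _ _ hN)
  have hM : N * R ≤ D * N ^ 3 := (Nat.mul_le_mul_left N hR).trans (by ring_nf; rfl)
  have hD23 : D * N ^ 2 ≤ D * N ^ 3 := Nat.mul_le_mul_left _ h23
  have hD34 : D * N ^ 3 ≤ D * N ^ 4 := Nat.mul_le_mul_left _ h34
  have hMN : N * R * (N + 2) ≤ 3 * (D * N ^ 4) := by
    calc N * R * (N + 2) ≤ D * N ^ 3 * (3 * N) := Nat.mul_le_mul hM (by omega)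
      _ = 3 * (D * N ^ 4) := by ring
  have ha : R + E + 2 * (N * R) + 3 ≤ 7 * (D * N ^ 3) := by have := hone 3; omega
  have ha' : R + E + 2 * (N * R) + 4 ≤ 8 * (D * N ^ 3) := by have := hone 3; omega
  have hb : R + E + N * R * (N + 2) + 3 ≤ 8 * (D * N ^ 4) := by have := hone 4; omega
  have hEa : E * (R + E + 2 * (N * R) + 3) ≤ 7 * (D ^ 2 * N ^ 5) :=
    (Nat.mul_le_mul hE ha).trans (by ring_nf; rfl)
  have hEa' : E * (R + E + 2 * (N * R) + 4) ≤ 8 * (D ^ 2 * N ^ 5) :=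
    (Nat.mul_le_mul hE ha').trans (by ring_nf; rfl)
  have hDD : D ≤ D ^ 2 := Nat.le_self_pow two_ne_zero D
  have hDD5 : D * N ^ 5 ≤ D ^ 2 * N ^ 5 := Nat.mul_le_mul_right _ hDD
  have hnb : n * (R + E + N * R * (N + 2) + 3) ≤ 8 * (D ^ 2 * N ^ 5) := by
    calc _ ≤ N * (8 * (D * N ^ 4)) := Nat.mul_le_mul hnN hb
      _ = 8 * (D * N ^ 5) := by ring
      _ ≤ _ := by omega
  have hn1 : n + 1 ≤ 2 * (D ^ 2 * N ^ 5) := by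
    have : N ≤ N ^ 5 := Nat.le_self_pow (by norm_num) N
    have : N ^ 5 ≤ D * N ^ 5 := Nat.le_mul_of_pos_left _ hD1
    omega
  have hinner : n + 1 + (n * (R + E + N * R * (N + 2) + 3) + E * (R + E + 2 * (N * R) + 4)) ≤
      18 * (D ^ 2 * N ^ 5) := by omega
  have h89 : D ^ 3 * N ^ 8 ≤ D ^ 3 * N ^ 9 :=
    Nat.mul_le_mul_left _ (Nat.pow_le_pow_right hN (by norm_num))
  have h59 : D ^ 2 * N ^ 5 ≤ D ^ 3 * N ^ 9 :=
    Nat.mul_le_mul (Nat.pow_le_pow_right hD1 (by norm_num)) (Nat.pow_le_pow_right hN (by norm_num))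
  have hflood : (N + 1) * (E * (n + 1 +
      (n * (R + E + N * R * (N + 2) + 3) + E * (R + E + 2 * (N * R) + 4)))) ≤
      36 * (D ^ 3 * N ^ 8) := by
    calc _ ≤ (2 * N) * (D * N ^ 2 * (18 * (D ^ 2 * N ^ 5))) :=
          Nat.mul_le_mul (by omega) (Nat.mul_le_mul hE hinner)
      _ = _ := by ring
  calc _ ≤ 7 * (D ^ 3 * N ^ 9) + 36 * (D ^ 3 * N ^ 9) := by
        refine add_le_add (hEa.trans ?_) (hflood.trans ?_) <;> omega
    _ = _ := by ring

end Complexity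

end LeaderElection

theorem corollary1 (ε : ℝ) (hε₀ : 0 < ε) (hε₁ : ε < 1) :
    ∃ A : AnonymousQuantumAlgorithm,
      -- correctness, on every strongly connected digraph with every port numbering
      (∀ (N n : ℕ) (G : MultiDigraph n) (σ : G.PortNumbering),
        1 ≤ n → n ≤ N → G.StronglyConnected → A.SolvesLEZeroError N σ ε) ∧
      -- the number of rounds is linear in `N`
      (∃ C : ℕ, ∀ N : ℕ, 1 ≤ N → A.rounds N ≤ C * N) ∧
      -- the bit complexity is `N ^ 9` up to logarithmic factors on networks with `O(N ^ 2)` links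
      (∃ k : ℕ, ∀ K : ℕ, ∃ C : ℝ, ∀ (N n : ℕ) (G : MultiDigraph n) (σ : G.PortNumbering),
        1 ≤ n → n ≤ N → G.StronglyConnected → G.numEdges ≤ K * N ^ 2 →
          A.BitComplexityAtMost N σ (C * (N : ℝ) ^ 9 * (1 + Real.log N) ^ k)) := by
  have hc : 0 < ⌈1 / ε⌉₊ := Nat.ceil_pos.2 (by positivity)
  -- The choice `c = ⌈1 / ε⌉₊` makes the failure bound `1 / c` at most `ε`. The bound on the bits is
  -- a pure power of `N`, so the logarithmic exponent is `0`.
  refine ⟨LeaderElection.algorithm ⌈1 / ε⌉₊, ?_, ⟨3, fun N hN => ?_⟩, 0, fun K =>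
    ⟨(43 * (⌈1 / ε⌉₊ + K + 1) ^ 3 : ℕ), ?_⟩⟩
  · intro N n G σ hn hnN hG
    constructor
    · rintro o ⟨h, y, hl, rfl, hne⟩
      exact LeaderElection.mem_uniqueLeader_or_eq_allGiveUp σ hn hnN hG hl hne
    · refine le_trans ?_ (LeaderElection.one_sub_le_outputProb σ hn hnN hG hc)
      have : 1 / (⌈1 / ε⌉₊ : ℝ) ≤ ε := by
        rw [one_div_le (by exact_mod_cast hc) hε₀]
        exact Nat.le_ceil _
      linarith
  · show N + 2 ≤ 3 * N
    omega
  · rintro N n G σ hn hnN hG hK h hl ⟨y, hne⟩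
    rw [pow_zero, mul_one]
    exact_mod_cast LeaderElection.bitsSent_le σ hn hnN hG hK hl hne
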